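/- Let $K$ be a field of characteristic $0$ (for instance $K=\mathbb{C}(d)$ with $d$ an indeterminate, or $K=\mathbb{C}$), let $n\ge 1$, and let $d\in K$ with $d\notin\{0,-2,-4,\dots,-2n+4\}$ (no condition for $n=1$). Let $VTL_n(d)$ be the $n$-strand virtual Temperley–Lieb algebra (the Brauer algebra): the $K$-vector space whose basis is the set of Brauer diagrams, i.e. perfect matchings (by "strands") of a row of $n$ top points and a row of $n$ bottom points, with product given by stacking the first diagram on top of the second and replacing each closed curve by a factor $d$. For $1\le i\le n-1$ let $e_i$ be the diagram joining the points $i,i+1$ of the top row, joining the points $i,i+1$ of the bottom row, and having vertical strands elsewhere; let $v_i$ be the diagram joining top point $i$ to bottom point $i+1$ and top point $i+1$ to bottom point $i$, with vertical strands elsewhere. Define $f_1,\dots,f_n\in VTL_n(d)$ recursively by $f_1=1_n$ and, for $2\le i\le n$, $$f_i=x_{i-1}f_{i-1}+y_{i-1}f_{i-1}e_{i-1}f_{i-1}+z_{i-1}f_{i-1}v_{i-1}f_{i-1},$$ where $x_i=\frac1{i+1}$, $y_i=-\frac{2i}{(i+1)(d+2i-2)}$, $z_i=\frac{i}{i+1}$.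 For $0\le k\le n$ let $[k]_n\in VTL_n(d)$ be the sum of all Brauer diagrams with exactly $k$ through strands (strands joining a top point to a bottom point). Then $$f_n=\sum_{l=0}^{\lfloor n/2\rfloor}\frac{(-2)^l\,l!}{n!\prod_{i=1}^{l}(d+2n-2-2i)}\,[n-2l]_n .$$ -/

import Mathlib

open Finset

/-- A Brauer diagram (connection element) on `n` top points `Sum.inl i` and `n` bottom points
`Sum.inr i`: a perfect matching of the `2 n` points, given as the fixed-point-free involution
that sends each point to the other end of its strand. -/
abbrev BrauerDiagram (n : ℕ) : Type :=
  {σ : Fin n ⊕ Fin n → Fin n ⊕ Fin n // Function.Involutive σ ∧ ∀ p, σ p ≠ p}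

instance (n : ℕ) : Fintype (BrauerDiagram n) :=
  inferInstanceAs (Fintype {σ : Fin n ⊕ Fin n → Fin n ⊕ Fin n //
    (∀ p, σ (σ p) = p) ∧ ∀ p, σ p ≠ p})

namespace BrauerDiagram

/-- The points of two stacked rectangles: top, middle and bottom row. -/
inductive Stack (n : ℕ) : Type
  | top (i : Fin n) : Stack n
  | mid (i : Fin n) : Stack n
  | bot (i : Fin n) : Stack n

variable {n : ℕ}

/-- The boundary points of the upper rectangle inside the stack. -/
def upper : Fin n ⊕ Fin n → Stack n
  | Sum.inl i => Stack.top i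
  | Sum.inr i => Stack.mid i

/-- The boundary points of the lower rectangle inside the stack. -/
def lower : Fin n ⊕ Fin n → Stack n
  | Sum.inl i => Stack.mid i
  | Sum.inr i => Stack.bot i

/-- The boundary points of the whole stack. -/
def outer : Fin n ⊕ Fin n → Stack n
  | Sum.inl i => Stack.top i
  | Sum.inr i => Stack.bot i

/-- The strands of the stack with `D` in the upper and `E` in the lower rectangle. -/
inductive Strand (D E : BrauerDiagram n) : Stack n → Stack n → Prop
  | upper (a : Fin n ⊕ Fin n) : Strand D E (upper a) (upper (D.1 a))
  | lower (a : Fin n ⊕ Fin n) : Strand D E (lower a) (lower (E.1 a))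

/-- The equivalence relation on the points of the stack whose classes are the connected
components of the stacked curves. -/
def component (D E : BrauerDiagram n) : Setoid (Stack n) :=
  Relation.EqvGen.setoid (Strand D E)

/-- The number of closed curves in the stack: the components that reach no boundary point. -/
noncomputable def loops (D E : BrauerDiagram n) : ℕ :=
  Nat.card {c : Quotient (component D E) // ∀ a, Quotient.mk (component D E) (outer a) ≠ c}

/-! Each boundary point of the stack is joined to exactly one other boundary point. -/

theorem partner_aux {V : Type*} [Finite V] (α β : V → V) (hα : Function.Involutive α)
    (hβ : Function.Involutive β) (r : V → V → Prop)
    (hrα : ∀ p, Relation.EqvGen r p (α p)) (hrβ : ∀ p, Relation.EqvGen r p (β p))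
    (hr : ∀ p q, r p q → q = p ∨ q = α p ∨ q = β p)
    (x : V) (hx : β x = x) (hx' : α x ≠ x) :
    ∃! y, (α y = y ∨ β y = y) ∧ y ≠ x ∧ Relation.EqvGen r x y := by
  let A : Equiv.Perm V := hα.toPerm
  let B : Equiv.Perm V := hβ.toPerm
  have hA : A * A = 1 := by ext p; exact hα p
  have hB : B * B = 1 := by ext p; exact hβ p
  have hAi : A⁻¹ = A := inv_eq_of_mul_eq_one_right hA
  have hBi : B⁻¹ = B := inv_eq_of_mul_eq_one_right hB
  let π : Equiv.Perm V := B * A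
  have hconj : B * π * B⁻¹ = π⁻¹ := by
    simp only [π, mul_inv_rev, hAi, hBi, ← mul_assoc, hB, one_mul]
  have hBk (k : ℤ) : β ((π ^ k) x) = (π ^ (-k)) x := by
    have h : B * π ^ k * B⁻¹ = π ^ (-k) := by rw [← conj_zpow, hconj, inv_zpow, zpow_neg]
    calc β ((π ^ k) x) = (B * π ^ k * B⁻¹) x := by
          rw [hBi]; simp only [Equiv.Perm.mul_apply]
          change _ = B ((π ^ k) (β x)); rw [hx]; rfl
      _ = _ := by rw [h]
  have hAk (k : ℤ) : α ((π ^ k) x) = (π ^ (-(k + 1))) x := by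
    rw [← hBk, add_comm, zpow_add, zpow_one]
    exact (hβ _).symm
  let m : ℕ := Function.minimalPeriod π x
  have hper (k l : ℤ) : (π ^ k) x = (π ^ l) x ↔ (m : ℤ) ∣ k - l := by
    refine Iff.trans ?_ (MulAction.zpow_smul_eq_iff_minimalPeriod_dvd (a := π) (b := x))
    rw [Equiv.Perm.smul_def, sub_eq_neg_add, zpow_add, Equiv.Perm.mul_apply, zpow_neg,
      Equiv.Perm.inv_eq_iff_eq]
  have hm0 : 0 < m := Function.minimalPeriod_pos_of_mem_periodicPts
    (Function.Injective.mem_periodicPts π.injective x)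
  have hm1 : m ≠ 1 := by
    intro h
    have h1 := (hper 1 0).2 (by rw [h]; exact one_dvd _)
    rw [zpow_one, zpow_zero] at h1
    have h2 : β (α x) = x := h1
    exact hx' (hβ.injective (h2.trans hx.symm))
  have horb : ∀ y, Relation.EqvGen r x y ↔ ∃ k : ℤ, (π ^ k) x = y := by
    have hcl : ∀ p q, Relation.EqvGen r p q →
        ((∃ k : ℤ, (π ^ k) x = p) ↔ ∃ k : ℤ, (π ^ k) x = q) := by
      intro p q h
      induction h with
      | rel p q h =>
        rcases hr p q h with rfl | rfl | rfl
        · rfl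
        · constructor
          · rintro ⟨k, rfl⟩; exact ⟨_, (hAk k).symm⟩
          · rintro ⟨k, hk⟩; exact ⟨-(k + 1), by rw [← hAk, hk, hα]⟩
        · constructor
          · rintro ⟨k, rfl⟩; exact ⟨_, (hBk k).symm⟩
          · rintro ⟨k, hk⟩; exact ⟨-k, by rw [← hBk, hk, hβ]⟩
      | refl => rfl
      | symm _ _ _ ih => exact ih.symm
      | trans _ _ _ _ _ ih1 ih2 => exact ih1.trans ih2
    have hstep (p : V) : Relation.EqvGen r p (π p) :=
      (hrα p).trans _ _ _ (hrβ (α p))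
    intro y
    constructor
    · intro h; exact (hcl x y h).1 ⟨0, by simp⟩
    · rintro ⟨k, rfl⟩
      induction k using Int.induction_on with
      | zero => exact Relation.EqvGen.refl _
      | succ k ih =>
        refine ih.trans _ _ _ ?_
        rw [add_comm, zpow_add, zpow_one]
        exact hstep _
      | pred k ih =>
        refine ih.trans _ _ _ (Relation.EqvGen.symm _ _ ?_)
        have := hstep ((π ^ (-(k : ℤ) - 1)) x)
        rwa [← Equiv.Perm.mul_apply, ← zpow_one_add, add_sub_cancel] at this
  have hchar (k : ℤ) : ((α ((π ^ k) x) = (π ^ k) x ∨ β ((π ^ k) x) = (π ^ k) x) ∧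
      (π ^ k) x ≠ x) ↔ (m : ℤ) ∣ k - (m / 2 : ℕ) := by
    have e0 : (π ^ k) x = x ↔ (m : ℤ) ∣ k := by
      have := hper k 0
      simpa using this
    rw [hAk, hBk, hper, hper, Ne, e0]
    constructor
    · rintro ⟨⟨c, hc⟩ | ⟨c, hc⟩, h⟩
      · have h1 : (2 * k + 1) = m * (-c) := by linarith
        rcases Nat.even_or_odd' m with ⟨j, hj | hj⟩
        · exfalso
          have : (2 * k + 1) = 2 * (j * (-c)) := by rw [h1, hj]; push_cast; ring
          omega
        · have hodd : Odd ((m : ℤ) * (-c)) := ⟨k, by linarith⟩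
          obtain ⟨t, ht⟩ := (Int.odd_mul.1 hodd).2
          have h2 : m / 2 = j := by omega
          refine ⟨t, ?_⟩
          rw [h2]
          rw [ht, hj] at h1
          rw [hj]
          push_cast at h1 ⊢
          linarith
      · have h1 : 2 * k = m * (-c) := by linarith
        rcases Nat.even_or_odd' m with ⟨j, hj | hj⟩
        · have h3 : k = j * (-c) := by
            have : 2 * k = 2 * (j * (-c)) := by rw [h1, hj]; push_cast; ring
            linarith
          rcases Int.even_or_odd' (-c) with ⟨t, ht | ht⟩
          · exact absurd ⟨t, by rw [h3, ht, hj]; push_cast; ring⟩ h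
          · refine ⟨t, ?_⟩
            have h2 : m / 2 = j := by omega
            rw [h2, h3, ht, hj]; push_cast; ring
        · exfalso
          have hev : Even ((m : ℤ) * (-c)) := ⟨k, by linarith⟩
          rcases Int.even_mul.1 hev with h2 | ⟨t, ht⟩
          · have : Odd (m : ℤ) := ⟨j, by rw [hj]; push_cast; ring⟩
            exact (Int.not_even_iff_odd.2 this) h2
          · exact h ⟨t, by rw [ht] at h1; linarith⟩
    · rintro ⟨c, hc⟩
      have hk : k = m * c + (m / 2 : ℕ) := by linarith
      refine ⟨?_, ?_⟩
      · rcases Nat.even_or_odd' m with ⟨j, hj | hj⟩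
        · right
          have h2 : m / 2 = j := by omega
          exact ⟨-2 * c - 1, by rw [hk, h2, hj]; push_cast; ring⟩
        · left
          have h2 : m / 2 = j := by omega
          exact ⟨-2 * c - 1, by rw [hk, h2, hj]; push_cast; ring⟩
      · intro h
        rw [hk, dvd_add_right (dvd_mul_right _ _)] at h
        have := Nat.le_of_dvd (by omega) (Int.natCast_dvd_natCast.1 h)
        omega
  refine ⟨(π ^ ((m / 2 : ℕ) : ℤ)) x, ?_, ?_⟩
  · have h := (hchar ((m / 2 : ℕ) : ℤ)).2 (by simp)
    exact ⟨h.1, h.2, (horb _).2 ⟨_, rfl⟩⟩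
  · rintro y ⟨h1, h2, h3⟩
    obtain ⟨k, rfl⟩ := (horb y).1 h3
    exact (hper _ _).2 ((hchar k).1 ⟨h1, h2⟩)

def upStep (D : BrauerDiagram n) : Stack n → Stack n
  | Stack.top i => upper (D.1 (Sum.inl i))
  | Stack.mid i => upper (D.1 (Sum.inr i))
  | Stack.bot i => Stack.bot i

def loStep (E : BrauerDiagram n) : Stack n → Stack n
  | Stack.top i => Stack.top i
  | Stack.mid i => lower (E.1 (Sum.inl i))
  | Stack.bot i => lower (E.1 (Sum.inr i))

theorem upStep_upper (D : BrauerDiagram n) (a : Fin n ⊕ Fin n) :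
    upStep D (upper a) = upper (D.1 a) := by rcases a with i | i <;> rfl

theorem loStep_lower (E : BrauerDiagram n) (a : Fin n ⊕ Fin n) :
    loStep E (lower a) = lower (E.1 a) := by rcases a with i | i <;> rfl

theorem upper_inj : Function.Injective (upper (n := n)) := by
  rintro (i | i) (j | j) h <;> simp_all [upper]

theorem lower_inj : Function.Injective (lower (n := n)) := by
  rintro (i | i) (j | j) h <;> simp_all [lower]

theorem outer_inj : Function.Injective (outer (n := n)) := by
  rintro (i | i) (j | j) h <;> simp_all [outer]

instance : Finite (Stack n) := by
  refine Finite.of_surjective (fun p : (Fin n ⊕ Fin n) ⊕ Fin n =>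
    Sum.elim upper Stack.bot p) ?_
  rintro (i | i | i)
  · exact ⟨Sum.inl (Sum.inl i), rfl⟩
  · exact ⟨Sum.inl (Sum.inr i), rfl⟩
  · exact ⟨Sum.inr i, rfl⟩

theorem existsUnique_partner (D E : BrauerDiagram n) (a : Fin n ⊕ Fin n) :
    ∃! b, b ≠ a ∧ component D E (outer a) (outer b) := by
  have hα : Function.Involutive (upStep D) := by
    have h (c) : upStep D (upStep D (upper c)) = upper c := by
      rw [upStep_upper, upStep_upper, D.2.1]
    rintro (i | i | i)
    · exact h (Sum.inl i)
    · exact h (Sum.inr i)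
    · rfl
  have hβ : Function.Involutive (loStep E) := by
    have h (c) : loStep E (loStep E (lower c)) = lower c := by
      rw [loStep_lower, loStep_lower, E.2.1]
    rintro (i | i | i)
    · rfl
    · exact h (Sum.inl i)
    · exact h (Sum.inr i)
  have hα1 (c) : upStep D (upper c) ≠ upper c := fun h =>
    D.2.2 c (upper_inj ((upStep_upper D c).symm.trans h))
  have hβ1 (c) : loStep E (lower c) ≠ lower c := fun h =>
    E.2.2 c (lower_inj ((loStep_lower E c).symm.trans h))
  have hrα : ∀ p, Relation.EqvGen (Strand D E) p (upStep D p) := by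
    rintro (i | i | i)
    · exact Relation.EqvGen.rel _ _ (Strand.upper (Sum.inl i))
    · exact Relation.EqvGen.rel _ _ (Strand.upper (Sum.inr i))
    · exact Relation.EqvGen.refl _
  have hrβ : ∀ p, Relation.EqvGen (Strand D E) p (loStep E p) := by
    rintro (i | i | i)
    · exact Relation.EqvGen.refl _
    · exact Relation.EqvGen.rel _ _ (Strand.lower (Sum.inl i))
    · exact Relation.EqvGen.rel _ _ (Strand.lower (Sum.inr i))
  have hr : ∀ p q, Strand D E p q → q = p ∨ q = upStep D p ∨ q = loStep E p := by
    rintro _ _ (c | c)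
    · exact Or.inr (Or.inl (upStep_upper D c).symm)
    · exact Or.inr (Or.inr (loStep_lower E c).symm)
  have hfix : ∀ y, (upStep D y = y ∨ loStep E y = y) ↔ ∃ b, outer b = y := by
    rintro (i | i | i)
    · exact ⟨fun _ => ⟨Sum.inl i, rfl⟩, fun _ => Or.inr rfl⟩
    · constructor
      · rintro (h | h)
        · exact absurd h (hα1 (Sum.inr i))
        · exact absurd h (hβ1 (Sum.inl i))
      · rintro ⟨b | b, hb⟩ <;> simp [outer] at hb
    · exact ⟨fun _ => ⟨Sum.inr i, rfl⟩, fun _ => Or.inl rfl⟩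
  have key : ∃! y, (∃ b, outer b = y) ∧ y ≠ outer a ∧
      Relation.EqvGen (Strand D E) (outer a) y := by
    rcases a with i | i
    · simpa only [hfix] using partner_aux (upStep D) (loStep E) hα hβ (Strand D E) hrα hrβ hr
        (outer (Sum.inl i)) rfl (hα1 (Sum.inl i))
    · have hr' : ∀ p q, Strand D E p q → q = p ∨ q = loStep E p ∨ q = upStep D p :=
        fun p q h => (hr p q h).imp_right Or.symm
      have := partner_aux (loStep E) (upStep D) hβ hα (Strand D E) hrβ hrα hr'
        (outer (Sum.inr i)) rfl (hβ1 (Sum.inr i))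
      have hfix' (y) : (loStep E y = y ∨ upStep D y = y) ↔ ∃ b, outer b = y := by
        rw [or_comm, hfix]
      simpa only [hfix'] using this
  obtain ⟨y, ⟨⟨b, rfl⟩, h1, h2⟩, h3⟩ := key
  exact ⟨b, ⟨fun h => h1 (by rw [h]), h2⟩, fun c hc =>
    outer_inj (h3 _ ⟨⟨c, rfl⟩, fun h => hc.1 (outer_inj h), hc.2⟩)⟩

/-- The diagram obtained by stacking `D` on top of `E` and deleting the closed curves: it joins
each boundary point of the stack to the other boundary point of its component. -/
noncomputable def comp (D E : BrauerDiagram n) : BrauerDiagram n :=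
  ⟨fun a => (existsUnique_partner D E a).choose, by
    have spec (a) := (existsUnique_partner D E a).choose_spec
    refine ⟨fun a => ?_, fun a => (spec a).1.1⟩
    exact ((spec _).2 a ⟨(spec a).1.1.symm, (component D E).symm (spec a).1.2⟩).symm⟩

/-- The diagram of a permutation `s`, which joins the top point `i` to the bottom point `s i`. -/
def ofPerm (s : Equiv.Perm (Fin n)) : BrauerDiagram n :=
  ⟨Sum.elim (fun i => Sum.inr (s i)) (fun i => Sum.inl (s.symm i)), by
    constructor
    · rintro (i | i) <;> simp
    · rintro (i | i) <;> simp⟩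

/-- For `j ≠ k`, the diagram with strands joining `j` and `k` in the top row, `j` and `k` in the
bottom row, and vertical strands elsewhere. -/
def cupCap (j k : Fin n) (h : j ≠ k) : BrauerDiagram n :=
  ⟨Sum.elim
      (fun i => if i = j then Sum.inl k else if i = k then Sum.inl j else Sum.inr i)
      (fun i => if i = j then Sum.inr k else if i = k then Sum.inr j else Sum.inl i), by
    constructor
    · rintro (i | i) <;> by_cases h1 : i = j <;> by_cases h2 : i = k <;> simp_all
    · rintro (i | i) <;> by_cases h1 : i = j <;> by_cases h2 : i = k <;> simp_all [eq_comm]⟩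

/-- The number of through strands (strands from the top row to the bottom row). -/
def through (D : BrauerDiagram n) : ℕ :=
  #{i : Fin n | (D.1 (Sum.inl i)).isRight}

end BrauerDiagram

/-- The virtual Temperley-Lieb (Brauer) algebra with loop value `d`: formal linear combinations
of Brauer diagrams. -/
def VTL {K : Type*} [Field K] (n : ℕ) (_d : K) : Type _ := BrauerDiagram n →₀ K

namespace VTL

variable {K : Type*} [Field K] {n : ℕ} {d : K}

noncomputable instance : AddCommGroup (VTL n d) :=
  inferInstanceAs (AddCommGroup (BrauerDiagram n →₀ K))

noncomputable instance : Module K (VTL n d) :=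
  inferInstanceAs (Module K (BrauerDiagram n →₀ K))

/-- A diagram as an element of the algebra. -/
noncomputable def diag (d : K) (D : BrauerDiagram n) : VTL n d :=
  Finsupp.single D (1 : K)

/-- The bilinear extension of stacking, where every closed curve is replaced by a factor `d`. -/
noncomputable instance : Mul (VTL n d) where
  mul f g := Finsupp.sum f fun D a => Finsupp.sum g fun E b =>
    (a * b * d ^ BrauerDiagram.loops D E) • diag d (BrauerDiagram.comp D E)

noncomputable instance : One (VTL n d) where
  one := diag d (BrauerDiagram.ofPerm 1)

/-- The Temperley-Lieb generator `e_{i+1}` (points are numbered from `0`, so it joins the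
points `i` and `i + 1` of each row). -/
noncomputable def e (d : K) (i : ℕ) (h : i + 1 < n) : VTL n d :=
  diag d (BrauerDiagram.cupCap ⟨i, Nat.lt_of_succ_lt h⟩ ⟨i + 1, h⟩ (by simp))

/-- The virtual generator `v_{i+1}` (points are numbered from `0`, so it crosses the strands
at the points `i` and `i + 1`). -/
noncomputable def v (d : K) (i : ℕ) (h : i + 1 < n) : VTL n d :=
  diag d (BrauerDiagram.ofPerm (Equiv.swap ⟨i, Nat.lt_of_succ_lt h⟩ ⟨i + 1, h⟩))

/-- `x_i = 1 / (i + 1)`. -/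
def x (K : Type*) [Field K] (i : ℕ) : K := 1 / ((i : K) + 1)

/-- `y_i = - 2 i / ((i + 1) (d + 2 i - 2))`. -/
def y (d : K) (i : ℕ) : K := -(2 * (i : K)) / (((i : K) + 1) * (d + 2 * (i : K) - 2))

/-- `z_i = i / (i + 1)`. -/
def z (K : Type*) [Field K] (i : ℕ) : K := (i : K) / ((i : K) + 1)

/-- The elements `f_i` of the algebra on `n` strands, for `1 ≤ i ≤ n`: `f_1 = 1` and
`f_i = x_{i-1} f_{i-1} + y_{i-1} f_{i-1} e_{i-1} f_{i-1} + z_{i-1} f_{i-1} v_{i-1} f_{i-1}`.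
(The value at `i = 0` is not used.) -/
noncomputable def f (n : ℕ) (d : K) : (i : ℕ) → i ≤ n → VTL n d
  | 0, _ => 1
  | 1, _ => 1
  | i + 2, h =>
    x K (i + 1) • f n d (i + 1) (Nat.le_of_succ_le h)
      + y d (i + 1) •
        (f n d (i + 1) (Nat.le_of_succ_le h) * e d i h * f n d (i + 1) (Nat.le_of_succ_le h))
      + z K (i + 1) •
        (f n d (i + 1) (Nat.le_of_succ_le h) * v d i h * f n d (i + 1) (Nat.le_of_succ_le h))

/-- `[k]_n`, the sum of all Brauer diagrams on `n` strands with exactly `k` through strands. -/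
noncomputable def throughSum (n : ℕ) (d : K) (k : ℕ) : VTL n d :=
  ∑ D : BrauerDiagram n with D.through = k, diag d D

end VTL

/-! Write F_m (`symmetrizer n d m`) for the right-hand side of the formula on the first m strands,
extended by vertical strands, the coefficient of a diagram depending only on its number of
horizontal strands. The proof shows that F_m satisfies the recursion that defines f_m.

Two properties of F_m carry this. It absorbs permutations of the first m points on either side,
because the coefficients are invariant under them. It is also killed by every diagram `cupCap i j`
with i, j among the first m points: the coefficient of each diagram in the product is a count of
preimages, and it vanishes exactly by the two-term recursion of the weights in l
(`sum_weight_relabel`). The excluded values of d are those for which this recursion would divide by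
zero.

Consequently F_m F_k = F_k = F_k F_m for m ≤ k, so F_{m+1} = F_m F_{m+1} F_m. Expanding the middle
factor gives a sum of terms F_m D F_m, and D contributes nothing if it has a horizontal strand
inside the first m columns. What survives are the permutations of m+1 points and their twists, in
which the two ends of the last column are exchanged. The permutations fixing the last point give
F_m; all others lie in one double coset of S_m and give F_m v_m F_m, and their twists give F_m e_m
F_m. Counting them yields x_m, z_m and y_m (`symmetrizer_succ`).

Associativity of the product is reduced to that of matrices: counting two-colourings represents a
diagram by a matrix in which each closed curve counts 2. This matrix determines the diagram, and
powers of 2 record the number of loops, so the resulting identities hold for every d. -/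

namespace BrauerDiagram

/-! ### Two-colourings and colour matrices -/

variable {n : ℕ}

/-- A two-colouring of the boundary points is compatible with a diagram if it is constant along
each strand. -/
def Compat (D : BrauerDiagram n) (c : Fin n ⊕ Fin n → Bool) : Prop := ∀ a, c (D.1 a) = c a

instance (D : BrauerDiagram n) (c : Fin n ⊕ Fin n → Bool) : Decidable (Compat D c) :=
  inferInstanceAs (Decidable (∀ a, c (D.1 a) = c a))

theorem comp_spec (D E : BrauerDiagram n) (a : Fin n ⊕ Fin n) :
    component D E (outer a) (outer ((comp D E).1 a)) :=
  (existsUnique_partner D E a).choose_spec.1.2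

theorem eq_or_eq_comp_of_component {D E : BrauerDiagram n} {a b : Fin n ⊕ Fin n}
    (h : component D E (outer a) (outer b)) : b = a ∨ b = (comp D E).1 a := by
  by_cases hb : b = a
  · exact Or.inl hb
  · exact Or.inr ((existsUnique_partner D E a).choose_spec.2 b ⟨hb, h⟩)

/-- The colouring of the stack with given colours in the three rows. -/
def stackColour (c : Fin n ⊕ Fin n → Bool) (m : Fin n → Bool) : Stack n → Bool
  | Stack.top i => c (Sum.inl i)
  | Stack.mid i => m i
  | Stack.bot i => c (Sum.inr i)

theorem stackColour_upper (c : Fin n ⊕ Fin n → Bool) (m : Fin n → Bool) (a : Fin n ⊕ Fin n) :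
    stackColour c m (upper a) = Sum.elim (c ∘ Sum.inl) m a := by
  rcases a with i | i <;> rfl

theorem stackColour_lower (c : Fin n ⊕ Fin n → Bool) (m : Fin n → Bool) (a : Fin n ⊕ Fin n) :
    stackColour c m (lower a) = Sum.elim m (c ∘ Sum.inr) a := by
  rcases a with i | i <;> rfl

theorem stackColour_outer (c : Fin n ⊕ Fin n → Bool) (m : Fin n → Bool) (a : Fin n ⊕ Fin n) :
    stackColour c m (outer a) = c a := by
  rcases a with i | i <;> rfl

theorem stackColour_of_component {D E : BrauerDiagram n} {c : Fin n ⊕ Fin n → Bool}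
    {m : Fin n → Bool} (hD : Compat D (Sum.elim (c ∘ Sum.inl) m))
    (hE : Compat E (Sum.elim m (c ∘ Sum.inr))) {x y : Stack n} (h : component D E x y) :
    stackColour c m x = stackColour c m y := by
  induction h with
  | rel x y h =>
    rcases h with a | a
    · rw [stackColour_upper, stackColour_upper, hD a]
    · rw [stackColour_lower, stackColour_lower, hE a]
  | refl => rfl
  | symm _ _ _ ih => exact ih.symm
  | trans _ _ _ _ _ h1 h2 => exact h1.trans h2

/-- Compatible colourings of the middle row are the same as colourings of the components. -/
def midEquiv (D E : BrauerDiagram n) (c : Fin n ⊕ Fin n → Bool) :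
    {m : Fin n → Bool // Compat D (Sum.elim (c ∘ Sum.inl) m) ∧
      Compat E (Sum.elim m (c ∘ Sum.inr))} ≃
    {g : Quotient (component D E) → Bool // ∀ a, g (Quotient.mk _ (outer a)) = c a} where
  toFun m := ⟨Quotient.lift (stackColour c m.1)
    fun _ _ h => stackColour_of_component m.2.1 m.2.2 h, fun a => stackColour_outer _ _ _⟩
  invFun g := ⟨fun i => g.1 (Quotient.mk _ (Stack.mid i)), by
    have hU (a) : Sum.elim (c ∘ Sum.inl) (fun i => g.1 (Quotient.mk _ (Stack.mid i))) a =
        g.1 (Quotient.mk _ (upper a)) := by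
      rcases a with i | i
      · exact (g.2 (Sum.inl i)).symm
      · rfl
    have hL (a) : Sum.elim (fun i => g.1 (Quotient.mk _ (Stack.mid i))) (c ∘ Sum.inr) a =
        g.1 (Quotient.mk _ (lower a)) := by
      rcases a with i | i
      · rfl
      · exact (g.2 (Sum.inr i)).symm
    refine ⟨fun a => ?_, fun a => ?_⟩
    · rw [hU, hU]
      exact congrArg g.1 (Quotient.sound ((component D E).symm
        (Relation.EqvGen.rel _ _ (Strand.upper a))))
    · rw [hL, hL]
      exact congrArg g.1 (Quotient.sound ((component D E).symm
        (Relation.EqvGen.rel _ _ (Strand.lower a))))⟩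
  left_inv m := rfl
  right_inv g := by
    apply Subtype.ext
    funext q
    induction q using Quotient.inductionOn with
    | h x =>
      rcases x with i | i | i
      · exact (g.2 (Sum.inl i)).symm
      · rfl
      · exact (g.2 (Sum.inr i)).symm

/-- A component that reaches the boundary has its colour forced by `c`, consistently exactly when
`c` is constant along the strands of the composite; each closed curve is coloured freely in two
ways. -/
theorem card_component_colourings (D E : BrauerDiagram n) (c : Fin n ⊕ Fin n → Bool) :
    Nat.card {g : Quotient (component D E) → Bool // ∀ a, g (Quotient.mk _ (outer a)) = c a} =
      if Compat (comp D E) c then 2 ^ loops D E else 0 := by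
  classical
  split_ifs with h
  · have hc (a b) (hab : (Quotient.mk (component D E) (outer a)) = Quotient.mk _ (outer b)) :
        c a = c b := by
      rcases eq_or_eq_comp_of_component (Quotient.exact hab) with rfl | rfl
      · rfl
      · exact (h a).symm
    let Φ : {g : Quotient (component D E) → Bool // ∀ a, g (Quotient.mk _ (outer a)) = c a} ≃
        ({q : Quotient (component D E) // ∀ a, Quotient.mk (component D E) (outer a) ≠ q}
          → Bool) :=
      { toFun := fun g q => g.1 q.1
        invFun := fun k => ⟨fun q => if hq : ∀ a, Quotient.mk (component D E) (outer a) ≠ q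
            then k ⟨q, hq⟩ else c (not_forall.1 hq).choose, by
          intro a
          have hq : ¬ ∀ b, Quotient.mk (component D E) (outer b) ≠ Quotient.mk _ (outer a) :=
            fun h => h a rfl
          refine (dif_neg hq).trans ?_
          exact hc _ _ (not_not.1 (not_forall.1 hq).choose_spec)⟩
        left_inv := by
          intro g
          apply Subtype.ext
          funext q
          by_cases hq : ∀ a, Quotient.mk (component D E) (outer a) ≠ q
          · simp only [dif_pos hq]
          · simp only [dif_neg hq]
            rw [← g.2, not_not.1 (not_forall.1 hq).choose_spec]
        right_inv := by
          intro k
          funext q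
          simp only [dif_pos q.2] }
    rw [Nat.card_congr Φ, Nat.card_fun, loops]
    simp
  · rw [Nat.card_eq_zero]
    left
    constructor
    rintro ⟨g, hg⟩
    refine h fun a => ?_
    rw [← hg, ← hg, Quotient.sound (comp_spec D E a)]

/-- The colour matrix of a diagram. -/
def colourMatrix (D : BrauerDiagram n) : Matrix (Fin n → Bool) (Fin n → Bool) ℕ :=
  Matrix.of fun t b => if Compat D (Sum.elim t b) then 1 else 0

theorem colourMatrix_apply (D : BrauerDiagram n) (t b : Fin n → Bool) :
    colourMatrix D t b = if Compat D (Sum.elim t b) then 1 else 0 := rfl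

/-- An entry of the matrix product counts the colourings of the middle row compatible with both
diagrams, that is, the colourings of components with prescribed boundary colours. -/
theorem colourMatrix_mul (D E : BrauerDiagram n) :
    colourMatrix D * colourMatrix E = 2 ^ loops D E • colourMatrix (comp D E) := by
  ext t b
  have h := Nat.card_congr (midEquiv D E (Sum.elim t b))
  rw [card_component_colourings, Nat.card_eq_fintype_card, Fintype.card_subtype,
    Finset.card_filter] at h
  rw [Matrix.mul_apply, Matrix.smul_apply, colourMatrix_apply]
  simp only [Sum.elim_comp_inl, Sum.elim_comp_inr] at h
  simp only [colourMatrix_apply, smul_eq_mul, mul_ite, mul_one, mul_zero]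
  rw [← h]
  refine Finset.sum_congr rfl fun m _ => ?_
  by_cases h1 : Compat D (Sum.elim t m) <;> by_cases h2 : Compat E (Sum.elim m b) <;> simp [h1, h2]

theorem colourMatrix_injective : Function.Injective (colourMatrix (n := n)) := by
  intro D E h
  apply Subtype.ext
  funext a
  -- The indicator of the strand of `D` through `a`: compatibility with `E` forces `E` to have the
  -- same strand at `a`.
  let c : Fin n ⊕ Fin n → Bool := fun x => decide (x = a ∨ x = D.1 a)
  have hc : Sum.elim (c ∘ Sum.inl) (c ∘ Sum.inr) = c := Sum.elim_comp_inl_inr c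
  have hD : Compat D c := by
    intro x
    have h1 : D.1 x = a ↔ x = D.1 a := ⟨fun h => by rw [← h, D.2.1], fun h => by rw [h, D.2.1]⟩
    have h2 : D.1 x = D.1 a ↔ x = a := D.2.1.injective.eq_iff
    simp only [c, h1, h2, or_comm]
  have h1 := congrFun (congrFun h (c ∘ Sum.inl)) (c ∘ Sum.inr)
  rw [colourMatrix_apply, colourMatrix_apply, hc, if_pos hD] at h1
  have hE : Compat E c := by
    by_contra hE
    rw [if_neg hE] at h1
    exact one_ne_zero h1
  have h2 := hE a
  simp only [c, true_or, decide_true, decide_eq_true_eq] at h2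
  exact (h2.resolve_left (E.2.2 a)).symm

theorem eq_of_pow_smul_colourMatrix {D E : BrauerDiagram n} {k l : ℕ}
    (h : 2 ^ k • colourMatrix D = 2 ^ l • colourMatrix E) : D = E ∧ k = l := by
  -- The monochromatic entry is 1 for every diagram, so it reads off the power of 2.
  have hconst (G : BrauerDiagram n) : colourMatrix G (fun _ => true) (fun _ => true) = 1 := by
    rw [colourMatrix_apply, if_pos]
    intro a
    rcases a with i | i <;> rcases G.1 _ with j | j <;> rfl
  have h1 := congrFun (congrFun h (fun _ => true)) (fun _ => true)
  rw [Matrix.smul_apply, Matrix.smul_apply, hconst, hconst] at h1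
  have hkl : k = l := Nat.pow_right_injective le_rfl (by simpa using h1)
  subst hkl
  refine ⟨colourMatrix_injective ?_, rfl⟩
  ext t b
  have h2 := congrFun (congrFun h t) b
  rw [Matrix.smul_apply, Matrix.smul_apply] at h2
  exact Nat.eq_of_mul_eq_mul_left (by positivity) h2

/-- One matrix identity determines both the composite and its loop number, with no need to trace
curves. -/
theorem comp_eq_and_loops_eq {D E G : BrauerDiagram n} {k : ℕ}
    (h : colourMatrix D * colourMatrix E = 2 ^ k • colourMatrix G) :
    comp D E = G ∧ loops D E = k :=
  eq_of_pow_smul_colourMatrix ((colourMatrix_mul D E).symm.trans h)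

theorem comp_assoc_and_loops (D E G : BrauerDiagram n) :
    comp (comp D E) G = comp D (comp E G) ∧
      loops D E + loops (comp D E) G = loops E G + loops D (comp E G) := by
  apply eq_of_pow_smul_colourMatrix
  have h := Matrix.mul_assoc (colourMatrix D) (colourMatrix E) (colourMatrix G)
  rw [colourMatrix_mul D E, colourMatrix_mul E G, Matrix.smul_mul, Matrix.mul_smul,
    colourMatrix_mul, colourMatrix_mul, smul_smul, smul_smul, ← pow_add, ← pow_add] at h
  exact h

/-! ### Relabelling, permutation diagrams and mirror images -/

/-- The diagram whose boundary points are renamed by a permutation. -/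
def relabel (σ : Equiv.Perm (Fin n ⊕ Fin n)) (D : BrauerDiagram n) : BrauerDiagram n :=
  ⟨fun a => σ (D.1 (σ.symm a)), by
    refine ⟨fun a => by simp [D.2.1 _], fun a h => ?_⟩
    exact D.2.2 (σ.symm a) (σ.eq_symm_apply.2 h)⟩

theorem relabel_apply (σ : Equiv.Perm (Fin n ⊕ Fin n)) (D : BrauerDiagram n)
    (a : Fin n ⊕ Fin n) : (relabel σ D).1 a = σ (D.1 (σ.symm a)) := rfl

theorem relabel_relabel (σ τ : Equiv.Perm (Fin n ⊕ Fin n)) (D : BrauerDiagram n) :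
    relabel σ (relabel τ D) = relabel (σ * τ) D := rfl

theorem relabel_one (D : BrauerDiagram n) : relabel 1 D = D := rfl

theorem compat_relabel (σ : Equiv.Perm (Fin n ⊕ Fin n)) (D : BrauerDiagram n)
    (c : Fin n ⊕ Fin n → Bool) : Compat (relabel σ D) c ↔ Compat D (c ∘ σ) := by
  constructor
  · intro h a
    simpa [relabel_apply] using h (σ a)
  · intro h a
    simpa [relabel_apply] using h (σ.symm a)

theorem compat_ofPerm (s : Equiv.Perm (Fin n)) (t b : Fin n → Bool) :
    Compat (ofPerm s) (Sum.elim t b) ↔ b ∘ s = t := by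
  constructor
  · intro h
    funext i
    exact h (Sum.inl i)
  · rintro rfl (i | i) <;> simp [ofPerm]

/-- The colour matrix of a permutation diagram is a permutation matrix, so left multiplication by it
only reindexes rows. -/
theorem ofPerm_comp_and_loops (s : Equiv.Perm (Fin n)) (D : BrauerDiagram n) :
    comp (ofPerm s) D = relabel (Equiv.sumCongr s⁻¹ 1) D ∧ loops (ofPerm s) D = 0 := by
  apply comp_eq_and_loops_eq
  ext t b
  rw [Matrix.mul_apply, pow_zero, one_smul]
  have h1 (m : Fin n → Bool) : m ∘ s = t ↔ m = t ∘ s.symm := by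
    constructor
    · rintro rfl; funext i; simp
    · rintro rfl; funext i; simp
  simp only [colourMatrix_apply, compat_ofPerm, h1, ite_mul, one_mul, zero_mul,
    Finset.sum_ite_eq', Finset.mem_univ, if_true, compat_relabel]
  have : Sum.elim t b ∘ (Equiv.sumCongr s⁻¹ (1 : Equiv.Perm (Fin n))) =
      Sum.elim (t ∘ s.symm) b := by
    funext a; rcases a with i | i <;> rfl
  rw [this]

/-- The diagram turned upside down. -/
def mirror (D : BrauerDiagram n) : BrauerDiagram n := relabel (Equiv.sumComm _ _) D

theorem mirror_mirror (D : BrauerDiagram n) : mirror (mirror D) = D := by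
  apply Subtype.ext
  funext a
  simp [mirror, relabel]

theorem colourMatrix_mirror (D : BrauerDiagram n) :
    colourMatrix (mirror D) = (colourMatrix D).transpose := by
  ext t b
  rw [Matrix.transpose_apply, colourMatrix_apply, colourMatrix_apply]
  simp only [mirror, compat_relabel]
  have : Sum.elim t b ∘ (Equiv.sumComm (Fin n) (Fin n)) = Sum.elim b t := by
    funext a; rcases a with i | i <;> rfl
  simp only [this]

/-- Mirroring transposes the colour matrix. The resulting anti-automorphism lets each one-sided
statement below be transferred to the other side. -/
theorem comp_mirror_and_loops (D E : BrauerDiagram n) :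
    comp (mirror E) (mirror D) = mirror (comp D E) ∧ loops (mirror E) (mirror D) = loops D E := by
  apply comp_eq_and_loops_eq
  rw [colourMatrix_mirror, colourMatrix_mirror, colourMatrix_mirror, ← Matrix.transpose_mul,
    colourMatrix_mul, Matrix.transpose_smul]

theorem mirror_ofPerm (s : Equiv.Perm (Fin n)) : mirror (ofPerm s) = ofPerm s⁻¹ := by
  apply Subtype.ext
  funext a
  rcases a with i | i <;> rfl

theorem mirror_cupCap (j k : Fin n) (h : j ≠ k) : mirror (cupCap j k h) = cupCap j k h := by
  apply Subtype.ext
  funext a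
  rcases a with i | i <;> simp only [mirror, relabel, cupCap, Equiv.sumComm_apply,
    Equiv.sumComm_symm, Sum.swap_inl, Sum.swap_inr, Sum.elim_inl, Sum.elim_inr] <;>
    split_ifs <;> rfl

end BrauerDiagram

/-! ### Left multiplication by a cup-cap diagram -/

namespace BrauerDiagram

variable {n : ℕ}

theorem comp_eq_of_component {D E G : BrauerDiagram n}
    (h : ∀ a, component D E (outer a) (outer (G.1 a))) : comp D E = G := by
  apply Subtype.ext
  funext a
  exact ((eq_or_eq_comp_of_component (h a)).resolve_left (G.2.2 a)).symm

theorem component_upper (D E : BrauerDiagram n) (a : Fin n ⊕ Fin n) :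
    component D E (upper a) (upper (D.1 a)) := Relation.EqvGen.rel _ _ (Strand.upper a)

theorem component_lower (D E : BrauerDiagram n) (a : Fin n ⊕ Fin n) :
    component D E (lower a) (lower (E.1 a)) := Relation.EqvGen.rel _ _ (Strand.lower a)

section CupCap

variable (i j : Fin n) (h : i ≠ j) (D : BrauerDiagram n)

theorem cupCap_component_outer_lower (a : Fin n ⊕ Fin n) (hi : a ≠ Sum.inl i)
    (hj : a ≠ Sum.inl j) : component (cupCap i j h) D (outer a) (lower a) := by
  rcases a with k | k
  · have := component_upper (cupCap i j h) D (Sum.inl k)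
    have hki : k ≠ i := fun e => hi (by rw [e])
    have hkj : k ≠ j := fun e => hj (by rw [e])
    simpa [cupCap, hki, hkj, upper, outer, lower] using this
  · exact (component _ _).refl _

theorem cupCap_component_top :
    component (cupCap i j h) D (outer (Sum.inl i)) (outer (Sum.inl j)) := by
  simpa [cupCap, upper, outer, lower] using component_upper (cupCap i j h) D (Sum.inl i)

theorem cupCap_component_mid :
    component (cupCap i j h) D (lower (Sum.inl i)) (lower (Sum.inl j)) := by
  simpa [cupCap, upper, outer, lower] using component_upper (cupCap i j h) D (Sum.inr i)

/-- In the stack, the outer top points `i` and `j` are joined by the upper rectangle, and the far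
ends of the strands of `D` at `i` and `j` become joined through the middle row. Exchanging the
labels `j` and `D i` produces exactly these two strands; if `D` joins `i` to `j`, the exchange is
trivial. -/
theorem cupCap_comp :
    comp (cupCap i j h) D = relabel (Equiv.swap (Sum.inl j) (D.1 (Sum.inl i))) D := by
  apply comp_eq_of_component
  have hij : (Sum.inl i : Fin n ⊕ Fin n) ≠ Sum.inl j := fun e => h (Sum.inl_injective e)
  obtain ⟨p, hp⟩ : ∃ p, p = D.1 (Sum.inl i) := ⟨_, rfl⟩
  have hpi : D.1 p = Sum.inl i := by rw [hp, D.2.1]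
  have hpi' : p ≠ Sum.inl i := hp ▸ D.2.2 _
  have hdir (a) (h1 : a ≠ Sum.inl i) (h2 : a ≠ Sum.inl j) (h3 : a ≠ p)
      (h4 : D.1 a ≠ Sum.inl j) :
      component (cupCap i j h) D (outer a) (outer (D.1 a)) := by
    refine (component _ _).trans (cupCap_component_outer_lower i j h D a h1 h2) ?_
    refine (component _ _).trans (component_lower _ _ a) ?_
    refine (component _ _).symm (cupCap_component_outer_lower i j h D _ ?_ h4)
    intro e
    exact h3 (by rw [hp, ← e, D.2.1])
  have hpq (hpj : p ≠ Sum.inl j) :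
      component (cupCap i j h) D (outer p) (outer (D.1 (Sum.inl j))) := by
    refine (component _ _).trans (cupCap_component_outer_lower i j h D p hpi' hpj) ?_
    refine (component _ _).trans (component_lower _ _ p) ?_
    rw [hpi]
    refine (component _ _).trans (cupCap_component_mid i j h D) ?_
    refine (component _ _).trans (component_lower _ _ _) ?_
    refine (component _ _).symm (cupCap_component_outer_lower i j h D _ ?_ (D.2.2 _))
    intro e
    exact hpj (by rw [hp, ← e, D.2.1])
  intro a
  rw [relabel_apply, Equiv.symm_swap, ← hp]
  by_cases hai : a = Sum.inl i
  · subst hai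
    rw [Equiv.swap_apply_of_ne_of_ne hij hpi'.symm, ← hp, Equiv.swap_apply_right]
    exact cupCap_component_top i j h D
  by_cases haj : a = Sum.inl j
  · subst haj
    rw [Equiv.swap_apply_left, hpi, Equiv.swap_apply_of_ne_of_ne hij hpi'.symm]
    exact (component _ _).symm (cupCap_component_top i j h D)
  by_cases hap : a = p
  · subst hap
    have hne : D.1 (Sum.inl j) ≠ a := fun e => hij (by rw [← hpi, ← e, D.2.1])
    rw [Equiv.swap_apply_right, Equiv.swap_apply_of_ne_of_ne (D.2.2 _) hne]
    exact hpq haj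
  · rw [Equiv.swap_apply_of_ne_of_ne haj hap]
    have hne : D.1 a ≠ p := fun e => hai (by rw [← hpi, ← e, D.2.1])
    by_cases hDa : D.1 a = Sum.inl j
    · have ha : a = D.1 (Sum.inl j) := by rw [← hDa, D.2.1]
      have hpj : p ≠ Sum.inl j := fun e => hai (by rw [← hpi, e, ha])
      rw [hDa, Equiv.swap_apply_left, ha]
      exact (component _ _).symm (hpq hpj)
    · rw [Equiv.swap_apply_of_ne_of_ne hDa hne]
      exact hdir a hai haj hap hDa

theorem cupCap_outer_of_ne (hD : D.1 (Sum.inl i) ≠ Sum.inl j) (x : Stack n) :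
    ∃ a, component (cupCap i j h) D (outer a) x := by
  have hi : ∃ a, component (cupCap i j h) D (outer a) (lower (Sum.inl i)) :=
    ⟨D.1 (Sum.inl i), (component _ _).trans
      (cupCap_component_outer_lower i j h D _ (D.2.2 _) hD)
      ((component _ _).symm (component_lower _ _ _))⟩
  rcases x with k | k | k
  · exact ⟨Sum.inl k, (component _ _).refl _⟩
  · by_cases hki : k = i
    · rw [hki]; exact hi
    by_cases hkj : k = j
    · obtain ⟨a, ha⟩ := hi
      rw [hkj]
      exact ⟨a, (component _ _).trans ha (cupCap_component_mid i j h D)⟩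
    · exact ⟨Sum.inl k, cupCap_component_outer_lower i j h D (Sum.inl k)
        (fun e => hki (Sum.inl_injective e)) (fun e => hkj (Sum.inl_injective e))⟩
  · exact ⟨Sum.inr k, (component _ _).refl _⟩

theorem loops_cupCap_of_ne (hD : D.1 (Sum.inl i) ≠ Sum.inl j) :
    loops (cupCap i j h) D = 0 := by
  rw [loops, Nat.card_eq_zero]
  left
  constructor
  rintro ⟨q, hq⟩
  induction q using Quotient.inductionOn with
  | h x =>
    obtain ⟨a, ha⟩ := cupCap_outer_of_ne i j h D hD x
    exact hq a (Quotient.sound ha)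

theorem loops_cupCap_of_eq (hD : D.1 (Sum.inl i) = Sum.inl j) :
    loops (cupCap i j h) D = 1 := by
  have hD' : D.1 (Sum.inl j) = Sum.inl i := by rw [← hD, D.2.1]
  -- The closed curve consists of these two middle points; invariance of this set along strands
  -- shows that it does not meet the boundary.
  let P : Stack n → Prop := fun x => x = Stack.mid i ∨ x = Stack.mid j
  have hP : ∀ x y, component (cupCap i j h) D x y → (P x ↔ P y) := by
    intro x y hxy
    induction hxy with
    | rel x y hs =>
      rcases hs with a | a
      · rcases a with k | k <;> by_cases hki : k = i <;> by_cases hkj : k = j <;>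
          simp_all [cupCap, P, upper]
      · have key : ∀ b, P (lower b) ↔ b = Sum.inl i ∨ b = Sum.inl j := by
          rintro (k | k) <;> simp [P, lower]
        have h1 : D.1 a = Sum.inl i ↔ a = Sum.inl j := by
          rw [← hD', D.2.1.injective.eq_iff]
        have h2 : D.1 a = Sum.inl j ↔ a = Sum.inl i := by
          rw [← hD, D.2.1.injective.eq_iff]
        rw [key, key, h1, h2, or_comm]
    | refl => rfl
    | symm _ _ _ ih => exact ih.symm
    | trans _ _ _ _ _ h1 h2 => exact h1.trans h2
  rw [loops, Nat.card_eq_one_iff_unique]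
  refine ⟨⟨?_⟩, ⟨⟨Quotient.mk _ (Stack.mid i), ?_⟩⟩⟩
  · suffices H : ∀ q : {q // ∀ a, Quotient.mk (component (cupCap i j h) D) (outer a) ≠ q},
        q.1 = Quotient.mk _ (Stack.mid i) from
      fun q r => Subtype.ext ((H q).trans (H r).symm)
    rintro ⟨q, hq⟩
    induction q using Quotient.inductionOn with
    | h x =>
      rcases x with k | k | k
      · exact absurd rfl (hq (Sum.inl k))
      · by_cases hki : k = i
        · subst hki; rfl
        by_cases hkj : k = j
        · subst hkj
          exact Quotient.sound ((component _ _).symm (cupCap_component_mid i k h D))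
        · exact absurd (Quotient.sound (cupCap_component_outer_lower i j h D (Sum.inl k)
            (fun e => hki (Sum.inl_injective e)) (fun e => hkj (Sum.inl_injective e))))
            (hq (Sum.inl k))
      · exact absurd rfl (hq (Sum.inr k))
  · intro a ha
    have := (hP _ _ (Quotient.exact ha)).2 (Or.inl rfl)
    rcases a with k | k <;> simp [P, outer] at this

theorem loops_cupCap : loops (cupCap i j h) D = if D.1 (Sum.inl i) = Sum.inl j then 1 else 0 := by
  split_ifs with hD
  · exact loops_cupCap_of_eq i j h D hD
  · exact loops_cupCap_of_ne i j h D hD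

end CupCap

end BrauerDiagram

/-! ### The ring structure and the mirror anti-automorphism -/

namespace VTL

open BrauerDiagram

variable {K : Type*} [Field K] {n : ℕ} {d : K}

theorem linearCombination_linearCombination {ι M : Type*} [AddCommGroup M] [Module K M]
    (t : ι → ι → K) (w : ι → ι → M) (a b : ι →₀ K) :
    Finsupp.linearCombination K (fun D => Finsupp.linearCombination K fun E => t D E • w D E) a b =
      a.sum fun D r => b.sum fun E s => (r * s * t D E) • w D E := by
  rw [Finsupp.linearCombination_apply, Finsupp.sum, LinearMap.sum_apply]
  refine Finset.sum_congr rfl fun D _ => ?_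
  rw [LinearMap.smul_apply, Finsupp.linearCombination_apply, Finsupp.smul_sum]
  simp only [smul_smul, mul_assoc]

/-- The product as a bilinear map. -/
noncomputable def mulBilin (n : ℕ) (d : K) : VTL n d →ₗ[K] VTL n d →ₗ[K] VTL n d :=
  Finsupp.linearCombination K (M := VTL n d →ₗ[K] VTL n d) fun D : BrauerDiagram n =>
    Finsupp.linearCombination K (M := VTL n d) fun E : BrauerDiagram n =>
      d ^ loops D E • diag d (comp D E)

theorem mul_eq_mulBilin (a b : VTL n d) : a * b = mulBilin n d a b :=
  (linearCombination_linearCombination (fun D E => d ^ loops D E)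
    (fun D E => diag d (comp D E)) a b).symm

theorem diag_mul_diag (D E : BrauerDiagram n) :
    diag d D * diag d E = d ^ loops D E • diag d (comp D E) := by
  have : diag d D * diag d E = Finsupp.sum (Finsupp.single D (1 : K)) fun D r =>
    Finsupp.sum (Finsupp.single E (1 : K)) fun E s =>
    (r * s * d ^ loops D E) • diag d (comp D E) := rfl
  rw [this, Finsupp.sum_single_index, Finsupp.sum_single_index] <;> simp

theorem induction_diag {p : VTL n d → Prop} (a : VTL n d) (h0 : p 0)
    (hadd : ∀ a b, p a → p b → p (a + b)) (hsmul : ∀ (r : K) D, p (r • diag d D)) : p a := by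
  refine Finsupp.induction_linear (motive := p) a h0 hadd fun D r => ?_
  have : (Finsupp.single D r : BrauerDiagram n →₀ K) = r • Finsupp.single D (1 : K) := by simp
  rw [this]
  exact hsmul r D

theorem ofPerm_one_mul_diag (D : BrauerDiagram n) : diag d (ofPerm 1) * diag d D = diag d D := by
  rw [diag_mul_diag, (ofPerm_comp_and_loops 1 D).1, (ofPerm_comp_and_loops 1 D).2, pow_zero,
    one_smul]
  have : Equiv.sumCongr (1⁻¹ : Equiv.Perm (Fin n)) (1 : Equiv.Perm (Fin n)) = 1 := by
    ext a; rcases a with i | i <;> rfl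
  rw [this, relabel_one]

theorem diag_mul_ofPerm_one (D : BrauerDiagram n) : diag d D * diag d (ofPerm 1) = diag d D := by
  have h := comp_mirror_and_loops (ofPerm 1) (mirror D)
  rw [mirror_mirror, mirror_ofPerm, inv_one] at h
  have h2 : Equiv.sumCongr (1⁻¹ : Equiv.Perm (Fin n)) (1 : Equiv.Perm (Fin n)) = 1 := by
    ext a; rcases a with i | i <;> rfl
  rw [diag_mul_diag, h.1, h.2, (ofPerm_comp_and_loops 1 _).1, (ofPerm_comp_and_loops 1 _).2,
    pow_zero, one_smul, h2, relabel_one, mirror_mirror]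

/-- The ring structure on the Brauer algebra. -/
noncomputable abbrev ring (n : ℕ) (d : K) : Ring (VTL n d) where
  __ := (inferInstance : AddCommGroup (VTL n d))
  __ := (inferInstance : Mul (VTL n d))
  __ := (inferInstance : One (VTL n d))
  left_distrib a b c := by simp only [mul_eq_mulBilin, map_add]
  right_distrib a b c := by simp only [mul_eq_mulBilin, map_add, LinearMap.add_apply]
  zero_mul a := by simp only [mul_eq_mulBilin, map_zero, LinearMap.zero_apply]
  mul_zero a := by simp only [mul_eq_mulBilin, map_zero]
  mul_assoc a b c := by
    simp only [mul_eq_mulBilin]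
    induction a using induction_diag with
    | h0 => simp
    | hadd a a' h h' => simp only [map_add, LinearMap.add_apply, h, h']
    | hsmul r D =>
    induction b using induction_diag with
    | h0 => simp
    | hadd b b' h h' => simp only [map_add, LinearMap.add_apply, h, h']
    | hsmul s E =>
    induction c using induction_diag with
    | h0 => simp
    | hadd c c' h h' => simp only [map_add, h, h']
    | hsmul t G =>
    obtain ⟨h1, h2⟩ := comp_assoc_and_loops D E G
    simp only [map_smul, LinearMap.smul_apply, ← mul_eq_mulBilin, diag_mul_diag, smul_smul, h1]
    congr 1
    -- The two bracketings produce the same total number of loops, hence the same power of `d`.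
    have h3 := congrArg (fun k => d ^ k) h2
    simp only [pow_add] at h3
    linear_combination (r * s * t) * h3
  one_mul a := by
    change diag d (ofPerm 1) * a = a
    induction a using induction_diag with
    | h0 => simp [mul_eq_mulBilin]
    | hadd a a' h h' => rw [mul_eq_mulBilin, map_add, ← mul_eq_mulBilin, h, ← mul_eq_mulBilin, h']
    | hsmul r D => rw [mul_eq_mulBilin, map_smul, ← mul_eq_mulBilin, ofPerm_one_mul_diag]
  mul_one a := by
    change a * diag d (ofPerm 1) = a
    induction a using induction_diag with
    | h0 => simp [mul_eq_mulBilin]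
    | hadd a a' h h' =>
      rw [mul_eq_mulBilin, map_add, LinearMap.add_apply, ← mul_eq_mulBilin, h,
        ← mul_eq_mulBilin, h']
    | hsmul r D =>
      rw [mul_eq_mulBilin, map_smul, LinearMap.smul_apply, ← mul_eq_mulBilin,
        diag_mul_ofPerm_one]

attribute [local instance] ring

/-- The algebra structure on the Brauer algebra. -/
noncomputable abbrev algebra (n : ℕ) (d : K) : Algebra K (VTL n d) :=
  Algebra.ofModule (fun r a b => by simp only [mul_eq_mulBilin, map_smul, LinearMap.smul_apply])
    (fun r a b => by simp only [mul_eq_mulBilin, map_smul])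

attribute [local instance] algebra

theorem one_eq : (1 : VTL n d) = diag d (ofPerm 1) := rfl

/-- Turning diagrams upside down, as a linear map. -/
noncomputable def mirrorLin (n : ℕ) (d : K) : VTL n d →ₗ[K] VTL n d :=
  Finsupp.linearCombination K (M := VTL n d) fun D : BrauerDiagram n => diag d (mirror D)

theorem mirrorLin_diag (D : BrauerDiagram n) : mirrorLin n d (diag d D) = diag d (mirror D) := by
  have := Finsupp.linearCombination_single K (v := fun D : BrauerDiagram n => diag d (mirror D)) 1 D
  rw [one_smul] at this
  exact this

theorem mirrorLin_mul (a b : VTL n d) :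
    mirrorLin n d (a * b) = mirrorLin n d b * mirrorLin n d a := by
  induction a using induction_diag with
  | h0 => simp
  | hadd a a' h h' => simp only [add_mul, mul_add, map_add, h, h']
  | hsmul r D =>
  induction b using induction_diag with
  | h0 => simp
  | hadd b b' h h' => simp only [add_mul, mul_add, map_add, h, h']
  | hsmul s E =>
  simp only [map_smul, mirrorLin_diag, smul_mul_assoc, mul_smul_comm, diag_mul_diag,
    (comp_mirror_and_loops D E).1, (comp_mirror_and_loops D E).2]
  rw [smul_comm]

end VTL

/-! ### Counting horizontal strands; diagrams vertical beyond column m -/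

namespace BrauerDiagram

variable {n : ℕ}

/-- The number of top points that are joined to top points. -/
def lefts (D : BrauerDiagram n) : ℕ := #{i : Fin n | (D.1 (Sum.inl i)).isLeft}

theorem through_add_lefts (D : BrauerDiagram n) : D.through + D.lefts = n := by
  have := Finset.card_filter_add_card_filter_not (s := (Finset.univ : Finset (Fin n)))
    (fun i => (D.1 (Sum.inl i)).isRight = true)
  simpa [through, lefts, Sum.not_isRight] using this

theorem through_mirror (D : BrauerDiagram n) : (mirror D).through = D.through := by
  have hm (i : Fin n) : (mirror D).1 (Sum.inl i) = (D.1 (Sum.inr i)).swap := rfl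
  unfold through
  refine Finset.card_bij' (fun i _ => (D.1 (Sum.inr i)).elim id id)
    (fun i _ => (D.1 (Sum.inl i)).elim id id) ?_ ?_ ?_ ?_
  · intro i hi
    simp only [Finset.mem_filter, Finset.mem_univ, true_and, hm, Sum.isRight_swap] at hi ⊢
    obtain ⟨k, hk⟩ := Sum.isLeft_iff.1 hi
    have : D.1 (Sum.inl k) = Sum.inr i := by rw [← hk, D.2.1]
    simp [hk, this]
  · intro i hi
    simp only [Finset.mem_filter, Finset.mem_univ, true_and, hm, Sum.isRight_swap] at hi ⊢
    obtain ⟨k, hk⟩ := Sum.isRight_iff.1 hi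
    have : D.1 (Sum.inr k) = Sum.inl i := by rw [← hk, D.2.1]
    simp [hk, this]
  · intro i hi
    simp only [Finset.mem_filter, Finset.mem_univ, true_and, hm, Sum.isRight_swap] at hi
    obtain ⟨k, hk⟩ := Sum.isLeft_iff.1 hi
    have : D.1 (Sum.inl k) = Sum.inr i := by rw [← hk, D.2.1]
    simp [hk, this]
  · intro i hi
    simp only [Finset.mem_filter, Finset.mem_univ, true_and] at hi
    obtain ⟨k, hk⟩ := Sum.isRight_iff.1 hi
    have : D.1 (Sum.inr k) = Sum.inl i := by rw [← hk, D.2.1]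
    simp [hk, this]

theorem lefts_mirror (D : BrauerDiagram n) : (mirror D).lefts = D.lefts := by
  have h1 := through_add_lefts D
  have h2 := through_add_lefts (mirror D)
  rw [through_mirror] at h2
  omega

/-- Through strands use equally many points of both rows, so the two rows also have equally many
ends of horizontal strands. -/
theorem card_isRight_inr (D : BrauerDiagram n) :
    #{i : Fin n | (D.1 (Sum.inr i)).isRight} = D.lefts := by
  rw [← lefts_mirror, lefts]
  congr 1
  ext i
  simp [mirror, relabel]

theorem even_lefts (D : BrauerDiagram n) : Even D.lefts := by
  have h : ∑ i ∈ ({i : Fin n | (D.1 (Sum.inl i)).isLeft} : Finset (Fin n)), (1 : ZMod 2) = 0 := by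
    have key : ∀ i ∈ ({i : Fin n | (D.1 (Sum.inl i)).isLeft} : Finset (Fin n)),
        ∃ k, D.1 (Sum.inl i) = Sum.inl k := fun i hi =>
      Sum.isLeft_iff.1 (Finset.mem_filter.1 hi).2
    -- `D` pairs the ends of horizontal top strands without fixed points, so their number vanishes
    -- modulo 2.
    refine Finset.sum_involution (fun i _ => (D.1 (Sum.inl i)).elim id id) ?_ ?_ ?_ ?_
    · intro i _; decide
    · intro i hi _ e
      obtain ⟨k, hk⟩ := key i hi
      simp only [hk, Sum.elim_inl, id] at e
      exact D.2.2 _ (by rw [hk, e])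
    · intro i hi
      obtain ⟨k, hk⟩ := key i hi
      have : D.1 (Sum.inl k) = Sum.inl i := by rw [← hk, D.2.1]
      simp [hk, this]
    · intro i hi
      obtain ⟨k, hk⟩ := key i hi
      have : D.1 (Sum.inl k) = Sum.inl i := by rw [← hk, D.2.1]
      simp [hk, this]
  rw [Finset.sum_const, nsmul_one, ZMod.natCast_eq_zero_iff_even] at h
  exact h

theorem lefts_relabel_sumCongr (s t : Equiv.Perm (Fin n)) (D : BrauerDiagram n) :
    (relabel (Equiv.sumCongr s t) D).lefts = D.lefts := by
  unfold lefts
  refine Finset.card_equiv s.symm fun i => ?_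
  simp only [Finset.mem_filter, Finset.mem_univ, true_and]
  change (Equiv.sumCongr s t (D.1 (Sum.inl (s.symm i)))).isLeft = true ↔ _
  rcases D.1 (Sum.inl (s.symm i)) with k | k <;> simp

/-- Both conjugations replace the pairs {a, f a} and {p, f p} by {a, p} and {f a, f p}. -/
theorem swap_conj_involutive {V : Type*} [DecidableEq V] {f : V → V}
    (hf : Function.Involutive f) (hne : ∀ x, f x ≠ x) (a p x : V) :
    Equiv.swap (f a) p (f (Equiv.swap (f a) p x)) =
      Equiv.swap a (f p) (f (Equiv.swap a (f p) x)) := by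
  have h1 : ∀ x, f (f x) = x := hf
  have h2 : ∀ x y, f x = f y → x = y := fun x y h => hf.injective h
  simp only [Equiv.swap_apply_def]
  grind

theorem relabel_swap_eq (D : BrauerDiagram n) (a p : Fin n ⊕ Fin n) :
    relabel (Equiv.swap (D.1 a) p) D = relabel (Equiv.swap a (D.1 p)) D :=
  Subtype.ext (funext fun x => swap_conj_involutive D.2.1 D.2.2 a p x)

/-- The strands i–j on top and k–q at the bottom are recombined into through strands i–k and j–q, so
precisely `i` and `j` stop being ends of horizontal top strands. -/
theorem lefts_relabel_swap_of_both_right {D : BrauerDiagram n} {i j k q : Fin n}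
    (hij : D.1 (Sum.inl i) = Sum.inl j) (hkq : D.1 (Sum.inr k) = Sum.inr q) :
    (relabel (Equiv.swap (Sum.inl j) (Sum.inr k)) D).lefts + 2 = D.lefts := by
  have hji : D.1 (Sum.inl j) = Sum.inl i := by rw [← hij, D.2.1]
  have hne : i ≠ j := fun e => D.2.2 (Sum.inl i) (by rw [hij, e])
  have hqk : q ≠ k := fun e => D.2.2 (Sum.inr k) (by rw [hkq, e])
  have hsub : ({i, j} : Finset (Fin n)) ⊆ ({x : Fin n | (D.1 (Sum.inl x)).isLeft} : Finset _) := by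
    intro x hx
    rcases Finset.mem_insert.1 hx with rfl | hx
    · simp [hij]
    · rw [Finset.mem_singleton.1 hx]; simp [hji]
  have hset : ({x : Fin n | ((relabel (Equiv.swap (Sum.inl j) (Sum.inr k)) D).1
      (Sum.inl x)).isLeft} : Finset (Fin n)) =
      ({x : Fin n | (D.1 (Sum.inl x)).isLeft} : Finset _) \ {i, j} := by
    ext x
    simp only [Finset.mem_filter, Finset.mem_univ, true_and, Finset.mem_sdiff, Finset.mem_insert,
      Finset.mem_singleton, not_or]
    simp only [relabel_apply, Equiv.symm_swap]
    by_cases hxj : x = j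
    · subst hxj
      rw [Equiv.swap_apply_left, hkq, Equiv.swap_apply_of_ne_of_ne (by simp) (by simpa using hqk)]
      simp
    have hx : (Sum.inl x : Fin n ⊕ Fin n) ≠ Sum.inl j := fun e => hxj (Sum.inl_injective e)
    rw [Equiv.swap_apply_of_ne_of_ne hx (by simp)]
    by_cases hxi : x = i
    · subst hxi
      rw [hij, Equiv.swap_apply_left]
      simp
    · have h1 : D.1 (Sum.inl x) ≠ Sum.inl j := fun e =>
        hxi (Sum.inl_injective (D.2.1.injective (e.trans hij.symm)))
      have h2 : D.1 (Sum.inl x) ≠ Sum.inr k := fun e => by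
        rw [← e, D.2.1] at hkq
        exact Sum.inl_ne_inr hkq
      rw [Equiv.swap_apply_of_ne_of_ne h1 h2]
      simp [hxi, hxj]
  have hc := Finset.card_sdiff_add_card_eq_card hsub
  rw [Finset.card_pair hne] at hc
  unfold lefts
  rw [hset, hc]

/-- Unless both `p` and `D p` lie at the bottom, the exchange can be written as one of two top
points (by `relabel_swap_eq` when only `D p` is on top), which does not alter the count. -/
theorem lefts_relabel_swap {D : BrauerDiagram n} {i j : Fin n}
    (hij : D.1 (Sum.inl i) = Sum.inl j) (p : Fin n ⊕ Fin n) :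
    (relabel (Equiv.swap (Sum.inl j) p) D).lefts =
      if p.isRight ∧ (D.1 p).isRight then D.lefts - 2 else D.lefts := by
  rcases p with k | k
  · rw [if_neg (by simp), ← Equiv.Perm.sumCongr_swap_one]
    exact lefts_relabel_sumCongr _ _ _
  rcases hq : D.1 (Sum.inr k) with q | q
  · rw [if_neg (by simp), ← hij, relabel_swap_eq, hq, ← Equiv.Perm.sumCongr_swap_one]
    exact lefts_relabel_sumCongr _ _ _
  · rw [if_pos (by simp)]
    have := lefts_relabel_swap_of_both_right hij hq
    omega

/-- The column of a boundary point. -/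
def column : Fin n ⊕ Fin n → ℕ := Sum.elim (fun i => i.1) fun i => i.1

/-- The diagrams with vertical strands in all columns from `m` on. -/
def verticalFrom (n m : ℕ) : Finset (BrauerDiagram n) :=
  {D | ∀ i : Fin n, m ≤ i.1 → D.1 (Sum.inl i) = Sum.inr i}

theorem mem_verticalFrom {m : ℕ} {D : BrauerDiagram n} :
    D ∈ verticalFrom n m ↔ ∀ i : Fin n, m ≤ i.1 → D.1 (Sum.inl i) = Sum.inr i := by
  simp [verticalFrom]

theorem apply_inr_of_mem_verticalFrom {m : ℕ} {D : BrauerDiagram n} (hD : D ∈ verticalFrom n m)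
    {i : Fin n} (hi : m ≤ i.1) : D.1 (Sum.inr i) = Sum.inl i := by
  rw [← mem_verticalFrom.1 hD i hi, D.2.1]

theorem column_apply_lt {m : ℕ} {D : BrauerDiagram n} (hD : D ∈ verticalFrom n m)
    {a : Fin n ⊕ Fin n} (ha : column a < m) : column (D.1 a) < m := by
  by_contra! hlt
  have : column a = column (D.1 a) := by
    rcases hb : D.1 a with k | k
    · rw [hb] at hlt
      rw [← D.2.1 a, hb, mem_verticalFrom.1 hD k hlt]; rfl
    · rw [hb] at hlt
      rw [← D.2.1 a, hb, apply_inr_of_mem_verticalFrom hD hlt]; rfl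
  omega

theorem column_lt_of_apply_inl {m : ℕ} {D : BrauerDiagram n} (hD : D ∈ verticalFrom n m)
    {i j : Fin n} (hij : D.1 (Sum.inl i) = Sum.inl j) : i.1 < m := by
  by_contra! hlt
  rw [mem_verticalFrom.1 hD i hlt] at hij
  exact Sum.inr_ne_inl hij

theorem column_lt_of_apply_inr {m : ℕ} {D : BrauerDiagram n} (hD : D ∈ verticalFrom n m)
    {i j : Fin n} (hij : D.1 (Sum.inr i) = Sum.inr j) : i.1 < m := by
  by_contra! hlt
  rw [apply_inr_of_mem_verticalFrom hD hlt] at hij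
  exact Sum.inl_ne_inr hij

theorem relabel_mem_verticalFrom {m : ℕ} {D : BrauerDiagram n} (hD : D ∈ verticalFrom n m)
    {σ : Equiv.Perm (Fin n ⊕ Fin n)} (hσ : ∀ a, m ≤ column a → σ a = a) :
    relabel σ D ∈ verticalFrom n m := by
  refine mem_verticalFrom.2 fun i hi => ?_
  have h1 : σ.symm (Sum.inl i) = Sum.inl i := by
    rw [Equiv.symm_apply_eq, hσ (Sum.inl i) hi]
  rw [relabel_apply, h1, mem_verticalFrom.1 hD i hi, hσ (Sum.inr i) hi]

theorem swap_apply_of_column {m : ℕ} {a b : Fin n ⊕ Fin n} (ha : column a < m)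
    (hb : column b < m) (x : Fin n ⊕ Fin n) (hx : m ≤ column x) : Equiv.swap a b x = x := by
  refine Equiv.swap_apply_of_ne_of_ne ?_ ?_
  · rintro rfl; omega
  · rintro rfl; omega

theorem mirror_mem_verticalFrom {m : ℕ} {D : BrauerDiagram n} (hD : D ∈ verticalFrom n m) :
    mirror D ∈ verticalFrom n m := by
  refine mem_verticalFrom.2 fun i hi => ?_
  have : (mirror D).1 (Sum.inl i) = (D.1 (Sum.inr i)).swap := rfl
  rw [this, apply_inr_of_mem_verticalFrom hD hi]; rfl

/-- The permutations that fix all points from `m` on. -/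
def permsBelow (n m : ℕ) : Finset (Equiv.Perm (Fin n)) := {s | ∀ i : Fin n, m ≤ i.1 → s i = i}

theorem mem_permsBelow {m : ℕ} {s : Equiv.Perm (Fin n)} :
    s ∈ permsBelow n m ↔ ∀ i : Fin n, m ≤ i.1 → s i = i := by
  simp [permsBelow]

theorem inv_mem_permsBelow {m : ℕ} {s : Equiv.Perm (Fin n)} (hs : s ∈ permsBelow n m) :
    s⁻¹ ∈ permsBelow n m := by
  refine mem_permsBelow.2 fun i hi => ?_
  rw [Equiv.Perm.inv_eq_iff_eq, mem_permsBelow.1 hs i hi]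

theorem card_permsBelow {m : ℕ} (hm : m ≤ n) : #(permsBelow n m) = m.factorial := by
  have h1 : #(permsBelow n m) =
      Fintype.card {f : Equiv.Perm (Fin n) // ∀ a, ¬ a.1 < m → f a = a} := by
    rw [Fintype.card_subtype, permsBelow]
    simp only [not_lt]
  rw [h1, ← Fintype.card_congr (Equiv.Perm.subtypeEquivSubtypePerm fun a : Fin n => a.1 < m),
    Fintype.card_perm, Fintype.card_subtype]
  congr 1
  rw [Fin.card_filter_val_lt, min_eq_right hm]

theorem ofPerm_injective : Function.Injective (ofPerm (n := n)) := by
  intro s t h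
  ext i
  have := congrFun (congrArg Subtype.val h) (Sum.inl i)
  simpa [ofPerm, Fin.ext_iff] using this

theorem lefts_ofPerm (s : Equiv.Perm (Fin n)) : (ofPerm s).lefts = 0 := by
  simp [lefts, ofPerm]

theorem ofPerm_mem_verticalFrom {m : ℕ} {s : Equiv.Perm (Fin n)} :
    ofPerm s ∈ verticalFrom n m ↔ s ∈ permsBelow n m := by
  simp [mem_verticalFrom, mem_permsBelow, ofPerm]

theorem exists_eq_ofPerm {D : BrauerDiagram n}
    (h : ∀ i, (D.1 (Sum.inl i)).isRight) : ∃ s : Equiv.Perm (Fin n), D = ofPerm s := by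
  have h1 (i : Fin n) : ∃ k, D.1 (Sum.inl i) = Sum.inr k := Sum.isRight_iff.1 (h i)
  choose g hg using h1
  have hinj : Function.Injective g := by
    intro i j hij
    exact Sum.inl_injective (D.2.1.injective (by rw [hg, hg, hij]))
  let s : Equiv.Perm (Fin n) := Equiv.ofBijective g (Finite.injective_iff_bijective.1 hinj)
  have hs (i : Fin n) : D.1 (Sum.inl i) = Sum.inr (s i) := hg i
  refine ⟨s, Subtype.ext (funext fun a => ?_)⟩
  rcases a with i | i
  · exact hs i
  · obtain ⟨k, rfl⟩ := s.surjective i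
    rw [← hs, D.2.1, hs]
    simp [ofPerm]

theorem isRight_of_lefts_eq_zero {D : BrauerDiagram n} (h : D.lefts = 0) (i : Fin n) :
    (D.1 (Sum.inl i)).isRight := by
  rw [lefts, Finset.card_eq_zero, Finset.filter_eq_empty_iff] at h
  simpa using h (Finset.mem_univ i)

theorem exists_inr_of_lefts_ne_zero {D : BrauerDiagram n} (h : D.lefts ≠ 0) :
    ∃ p q : Fin n, D.1 (Sum.inr p) = Sum.inr q := by
  rw [← card_isRight_inr, Finset.card_ne_zero] at h
  obtain ⟨p, hp⟩ := h
  exact ⟨p, Sum.isRight_iff.1 (Finset.mem_filter.1 hp).2⟩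

end BrauerDiagram

/-! ### Undoing a relabelling, and counts of boundary points -/

namespace BrauerDiagram

variable {n : ℕ}

theorem relabel_swap_swap (a b : Fin n ⊕ Fin n) (D : BrauerDiagram n) :
    relabel (Equiv.swap a b) (relabel (Equiv.swap a b) D) = D := by
  rw [relabel_relabel, Equiv.swap_mul_self, relabel_one]

theorem relabel_swap_apply_of_ne {D : BrauerDiagram n} {a b p : Fin n ⊕ Fin n}
    (hab : D.1 a = b) (hp : p ≠ a) : (relabel (Equiv.swap b p) D).1 a = p := by
  have hba : a ≠ b := fun e => D.2.2 a (by rw [hab, e])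
  rw [relabel_apply, Equiv.symm_swap, Equiv.swap_apply_of_ne_of_ne hba hp.symm, hab,
    Equiv.swap_apply_left]

theorem relabel_swap_apply_self {D : BrauerDiagram n} {a b : Fin n ⊕ Fin n} (hab : a ≠ b) :
    (relabel (Equiv.swap b (D.1 a)) D).1 a = b := by
  rw [relabel_apply, Equiv.symm_swap, Equiv.swap_apply_of_ne_of_ne hab (D.2.2 a).symm,
    Equiv.swap_apply_right]

theorem card_filter_sum {α β : Type*} [Fintype α] [Fintype β] (P : α ⊕ β → Prop)
    [DecidablePred P] :
    #{p : α ⊕ β | P p} = #{a : α | P (Sum.inl a)} + #{b : β | P (Sum.inr b)} := by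
  simp only [Finset.card_filter, Fintype.sum_sum_type]

theorem card_column_lt {m : ℕ} (hm : m ≤ n) :
    #{p : Fin n ⊕ Fin n | column p < m} = 2 * m := by
  have h : #{i : Fin n | i.1 < m} = m := by rw [Fin.card_filter_val_lt, min_eq_right hm]
  rw [card_filter_sum, two_mul]
  exact congrArg₂ (· + ·) h h

theorem card_both_right {m : ℕ} {D : BrauerDiagram n} (hD : D ∈ verticalFrom n m) :
    #{p : Fin n ⊕ Fin n | column p < m ∧ p.isRight ∧ (D.1 p).isRight} = D.lefts := by
  rw [← card_isRight_inr, card_filter_sum]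
  simp only [Sum.isRight_inl, Sum.isRight_inr, Bool.false_eq_true, false_and, and_false,
    Finset.filter_false, Finset.card_empty, zero_add, true_and]
  congr 1
  ext i
  simp only [Finset.mem_filter, Finset.mem_univ, true_and, and_iff_right_iff_imp]
  intro h
  obtain ⟨k, hk⟩ := Sum.isRight_iff.1 h
  exact column_lt_of_apply_inr hD hk

theorem lefts_le {m : ℕ} {D : BrauerDiagram n} (hm : m ≤ n) (hD : D ∈ verticalFrom n m) :
    D.lefts ≤ m := by
  rw [lefts, ← min_eq_right hm, ← Fin.card_filter_val_lt]
  refine Finset.card_le_card fun i hi => ?_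
  obtain ⟨k, hk⟩ := Sum.isLeft_iff.1 (Finset.mem_filter.1 hi).2
  exact Finset.mem_filter.2 ⟨Finset.mem_univ _, column_lt_of_apply_inl hD hk⟩

theorem lefts_pos {D : BrauerDiagram n} {i j : Fin n} (hij : D.1 (Sum.inl i) = Sum.inl j) :
    0 < D.lefts :=
  Finset.card_pos.2 ⟨i, by simp [hij]⟩

end BrauerDiagram

/-! ### The explicit symmetrizer: absorption, annihilation, idempotence -/

namespace VTL

open BrauerDiagram

variable {K : Type*} [Field K] {n : ℕ} {d : K}

attribute [local instance] ring algebra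

/-- The coefficient of the diagrams with `l` horizontal top strands in the symmetrizer on `m`
strands. -/
def weight (d : K) (m l : ℕ) : K :=
  (-2 : K) ^ l * (l.factorial : K) /
    ((m.factorial : K) * ∏ i ∈ Finset.Icc 1 l, (d + 2 * (m : K) - 2 - 2 * (i : K)))

/-- This two-term recursion in `l` is exactly the cancellation needed in `sum_weight_relabel`. -/
theorem weight_succ_mul (d : K) (m l : ℕ) (h : d + 2 * (m : K) - 2 - 2 * ((l + 1 : ℕ) : K) ≠ 0) :
    weight d m (l + 1) * (d + 2 * (m : K) - 2 - 2 * ((l + 1 : ℕ) : K)) =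
      -2 * ((l + 1 : ℕ) : K) * weight d m l := by
  rw [weight, weight, Finset.prod_Icc_succ_top (by omega), Nat.factorial_succ, pow_succ,
    ← mul_assoc, div_mul_eq_mul_div, mul_div_mul_right _ _ h]
  push_cast
  ring

/-- The Brauer symmetrizer on the first `m` of `n` strands, in explicit form. -/
noncomputable def symmetrizer (n : ℕ) (d : K) (m : ℕ) : VTL n d :=
  ∑ D ∈ verticalFrom n m, weight d m (D.lefts / 2) • diag d D

theorem ofPerm_mul_diag (s : Equiv.Perm (Fin n)) (D : BrauerDiagram n) :
    diag d (ofPerm s) * diag d D = diag d (relabel (Equiv.sumCongr s⁻¹ 1) D) := by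
  rw [diag_mul_diag, (ofPerm_comp_and_loops s D).1, (ofPerm_comp_and_loops s D).2, pow_zero,
    one_smul]

theorem diag_mul_ofPerm (s : Equiv.Perm (Fin n)) (D : BrauerDiagram n) :
    diag d D * diag d (ofPerm s) = diag d (relabel (Equiv.sumCongr 1 s) D) := by
  have h := congrArg (mirrorLin n d) (ofPerm_mul_diag (d := d) s⁻¹ (mirror D))
  rw [mirrorLin_mul, mirrorLin_diag, mirrorLin_diag, mirrorLin_diag, mirror_mirror, mirror_ofPerm,
    inv_inv] at h
  rw [h]
  congr 1
  apply Subtype.ext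
  funext a
  rcases a with i | i <;> simp only [mirror, relabel_apply] <;>
    simp only [Equiv.sumComm_symm, Equiv.sumComm_apply, Sum.swap_inl, Sum.swap_inr,
      Equiv.sumCongr_symm, Equiv.sumCongr_apply, Sum.map_inl, Sum.map_inr]
  · rcases D.1 _ with k | k <;> rfl
  · rcases D.1 _ with k | k <;> rfl

theorem cupCap_mul_diag {i j : Fin n} (h : i ≠ j) (D : BrauerDiagram n) :
    diag d (cupCap i j h) * diag d D =
      (if D.1 (Sum.inl i) = Sum.inl j then d else 1) •
        diag d (relabel (Equiv.swap (Sum.inl j) (D.1 (Sum.inl i))) D) := by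
  rw [diag_mul_diag, cupCap_comp, loops_cupCap]
  split_ifs <;> simp

theorem ofPerm_mul_symmetrizer {m : ℕ} {s : Equiv.Perm (Fin n)} (hs : s ∈ permsBelow n m) :
    diag d (ofPerm s) * symmetrizer n d m = symmetrizer n d m := by
  have key (t : Equiv.Perm (Fin n)) (ht : t ∈ permsBelow n m) (D : BrauerDiagram n)
      (hD : D ∈ verticalFrom n m) :
      relabel (Equiv.sumCongr t (1 : Equiv.Perm (Fin n))) D ∈ verticalFrom n m := by
    refine relabel_mem_verticalFrom hD fun a ha => ?_
    rcases a with k | k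
    · exact congrArg Sum.inl (mem_permsBelow.1 ht k ha)
    · rfl
  have hinv (t : Equiv.Perm (Fin n)) (D : BrauerDiagram n) (u : Equiv.Perm (Fin n))
      (h : t * u = 1) : relabel (Equiv.sumCongr t (1 : Equiv.Perm (Fin n)))
        (relabel (Equiv.sumCongr u (1 : Equiv.Perm (Fin n))) D) = D := by
    rw [relabel_relabel]
    have : Equiv.sumCongr t (1 : Equiv.Perm (Fin n)) * Equiv.sumCongr u (1 : Equiv.Perm (Fin n))
        = 1 := by
      have := Equiv.Perm.sumCongr_mul t (1 : Equiv.Perm (Fin n)) u (1 : Equiv.Perm (Fin n))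
      rw [h, one_mul, Equiv.Perm.sumCongr_one] at this
      exact this
    rw [this, relabel_one]
  simp only [symmetrizer, Finset.mul_sum, mul_smul_comm, ofPerm_mul_diag]
  refine Finset.sum_bij' (fun D _ => relabel (Equiv.sumCongr s⁻¹ (1 : Equiv.Perm (Fin n))) D)
    (fun D _ => relabel (Equiv.sumCongr s (1 : Equiv.Perm (Fin n))) D)
    (fun D hD => key _ (inv_mem_permsBelow hs) D hD) (fun D hD => key s hs D hD)
    (fun D _ => hinv _ _ _ (mul_inv_cancel s)) (fun D _ => hinv _ _ _ (inv_mul_cancel s))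
    fun D _ => ?_
  rw [lefts_relabel_sumCongr]

theorem mirrorLin_symmetrizer (m : ℕ) :
    mirrorLin n d (symmetrizer n d m) = symmetrizer n d m := by
  simp only [symmetrizer, map_sum, map_smul, mirrorLin_diag]
  refine Finset.sum_bij' (fun D _ => mirror D) (fun D _ => mirror D)
    (fun D hD => mirror_mem_verticalFrom hD) (fun D hD => mirror_mem_verticalFrom hD)
    (fun D _ => mirror_mirror D) (fun D _ => mirror_mirror D) fun D _ => ?_
  rw [lefts_mirror]

theorem symmetrizer_mul_ofPerm {m : ℕ} {s : Equiv.Perm (Fin n)} (hs : s ∈ permsBelow n m) :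
    symmetrizer n d m * diag d (ofPerm s) = symmetrizer n d m := by
  have h := congrArg (mirrorLin n d) (ofPerm_mul_symmetrizer (d := d) (inv_mem_permsBelow hs))
  rwa [mirrorLin_mul, mirrorLin_symmetrizer, mirrorLin_diag, mirror_ofPerm, inv_inv] at h

/-- The sum is the coefficient of `G` in the product of `cupCap i j` with the symmetrizer; `p`
records the partner of `i` in the preimage. If `G` has 2(l+1) ends of horizontal top strands, then
of the 2m-1 choices of `p`, the 2(l+1) ends of horizontal bottom strands give weight w_l and all
others w_{l+1}, with an extra factor `d` for p = j. The total is (d + 2m - 2 - 2(l+1)) w_{l+1} +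
2(l+1) w_l = 0. -/
theorem sum_weight_relabel {m : ℕ} (hm : m ≤ n)
    (hd : ∀ j : ℕ, j + 2 ≤ n → d ≠ -2 * (j : K)) {i j : Fin n} {G : BrauerDiagram n}
    (hG : G ∈ verticalFrom n m) (hij : G.1 (Sum.inl i) = Sum.inl j) :
    ∑ p ∈ ({p | column p < m ∧ p ≠ Sum.inl i} : Finset (Fin n ⊕ Fin n)),
      weight d m ((relabel (Equiv.swap (Sum.inl j) p) G).lefts / 2) *
        (if p = Sum.inl j then d else 1) = 0 := by
  classical
  have hji : G.1 (Sum.inl j) = Sum.inl i := by rw [← hij, G.2.1]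
  have him := column_lt_of_apply_inl hG hij
  have hjm := column_lt_of_apply_inl hG hji
  have hne : (Sum.inl j : Fin n ⊕ Fin n) ≠ Sum.inl i := fun e => G.2.2 (Sum.inl i) (by rw [hij, e])
  obtain ⟨l, hl⟩ : ∃ l, G.lefts = 2 * (l + 1) := by
    obtain ⟨k, hk⟩ := even_lefts G
    have := lefts_pos hij
    exact ⟨k - 1, by omega⟩
  have hlm := lefts_le hm hG
  have hnz : d + 2 * (m : K) - 2 - 2 * ((l + 1 : ℕ) : K) ≠ 0 := by
    intro h0
    -- A zero of the factor means d = -2(m-2-l), an excluded value; the truncated subtraction is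
    -- exact because 2(l+1) ≤ m.
    apply hd (m - 2 - l) (by omega)
    have hc : ((m - 2 - l : ℕ) : K) + 2 + l = m := by
      exact_mod_cast congrArg (Nat.cast (R := K)) (show m - 2 - l + 2 + l = m by omega)
    push_cast at h0
    linear_combination h0 + 2 * hc
  have hrec := weight_succ_mul d m l hnz
  -- Each term is the generic weight w_{l+1}, plus a correction on the bottom strands, plus a
  -- correction at p = j for the loop factor.
  have hterm (p : Fin n ⊕ Fin n) :
      weight d m ((relabel (Equiv.swap (Sum.inl j) p) G).lefts / 2) *
        (if p = Sum.inl j then d else 1) =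
      weight d m (l + 1) +
        (if p.isRight ∧ (G.1 p).isRight then weight d m l - weight d m (l + 1) else 0) +
        (if p = Sum.inl j then (d - 1) * weight d m (l + 1) else 0) := by
    rw [lefts_relabel_swap hij]
    have e1 : (2 * (l + 1) - 2) / 2 = l := by omega
    have e2 : 2 * (l + 1) / 2 = l + 1 := by omega
    by_cases hp : p = Sum.inl j
    · subst hp
      simp only [Sum.isRight_inl, Bool.false_eq_true, false_and, if_false, if_true, hl, e2]
      ring
    · simp only [if_neg hp, hl]
      split_ifs <;> simp only [e1, e2] <;> ring
  simp only [hterm, Finset.sum_add_distrib]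
  have hcard : #({p | column p < m ∧ p ≠ Sum.inl i} : Finset (Fin n ⊕ Fin n)) + 1 = 2 * m := by
    rw [← card_column_lt hm, ← Finset.card_erase_add_one (s := {p | column p < m})
      (a := Sum.inl i) (Finset.mem_filter.2 ⟨Finset.mem_univ _, him⟩)]
    congr 2
    ext p
    simp [and_comm]
  have hright : #(({p | column p < m ∧ p ≠ Sum.inl i} : Finset (Fin n ⊕ Fin n)).filter
      fun p => p.isRight ∧ (G.1 p).isRight) = 2 * (l + 1) := by
    rw [← hl, ← card_both_right hG]
    congr 1
    ext p
    rcases p with k | k <;> simp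
  have hjmem : Sum.inl j ∈ ({p | column p < m ∧ p ≠ Sum.inl i} : Finset (Fin n ⊕ Fin n)) := by
    simp only [Finset.mem_filter, Finset.mem_univ, true_and]
    exact ⟨hjm, hne⟩
  rw [Finset.sum_const, ← Finset.sum_filter, Finset.sum_const, hright, Finset.sum_ite_eq',
    if_pos hjmem, nsmul_eq_mul, nsmul_eq_mul]
  have hcard' := congrArg (fun k : ℕ => (k : K)) hcard
  push_cast at hcard' hrec ⊢
  linear_combination weight d m (l + 1) * hcard' + hrec

/-- Collecting terms by the resulting diagram `G`: a diagram D is recovered from `G` and the former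
partner p = D i, so the product splits into the sums over `p` that vanish by `sum_weight_relabel`.
-/
theorem cupCap_mul_symmetrizer {m : ℕ} (hm : m ≤ n)
    (hd : ∀ j : ℕ, j + 2 ≤ n → d ≠ -2 * (j : K)) {i j : Fin n} (h : i ≠ j)
    (hi : i.1 < m) (hj : j.1 < m) :
    diag d (cupCap i j h) * symmetrizer n d m = 0 := by
  classical
  have hij : (Sum.inl i : Fin n ⊕ Fin n) ≠ Sum.inl j := fun e => h (Sum.inl_injective e)
  simp only [symmetrizer, Finset.mul_sum, mul_smul_comm, cupCap_mul_diag, smul_smul]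
  have key : ∑ D ∈ verticalFrom n m, (weight d m (D.lefts / 2) *
      (if D.1 (Sum.inl i) = Sum.inl j then d else 1)) •
        diag d (relabel (Equiv.swap (Sum.inl j) (D.1 (Sum.inl i))) D) =
      ∑ x ∈ ((verticalFrom n m).filter fun G => G.1 (Sum.inl i) = Sum.inl j) ×ˢ
        ({p | column p < m ∧ p ≠ Sum.inl i} : Finset (Fin n ⊕ Fin n)),
      (weight d m ((relabel (Equiv.swap (Sum.inl j) x.2) x.1).lefts / 2) *
        (if x.2 = Sum.inl j then d else 1)) • diag d x.1 := by
    refine Finset.sum_bij'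
      (fun D _ => (relabel (Equiv.swap (Sum.inl j) (D.1 (Sum.inl i))) D, D.1 (Sum.inl i)))
      (fun x _ => relabel (Equiv.swap (Sum.inl j) x.2) x.1) ?_ ?_ ?_ ?_ ?_
    · intro D hD
      have hc : column (D.1 (Sum.inl i)) < m := column_apply_lt hD hi
      rw [Finset.mem_product, Finset.mem_filter, Finset.mem_filter]
      exact ⟨⟨relabel_mem_verticalFrom hD (swap_apply_of_column hj hc),
        relabel_swap_apply_self hij⟩, Finset.mem_univ _, hc, D.2.2 _⟩
    · intro x hx
      rw [Finset.mem_product, Finset.mem_filter, Finset.mem_filter] at hx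
      exact relabel_mem_verticalFrom hx.1.1 (swap_apply_of_column hj hx.2.2.1)
    · intro D _
      exact relabel_swap_swap _ _ _
    · intro x hx
      rw [Finset.mem_product, Finset.mem_filter, Finset.mem_filter] at hx
      have := relabel_swap_apply_of_ne hx.1.2 hx.2.2.2
      refine Prod.ext ?_ this
      simp only [this]
      exact relabel_swap_swap _ _ _
    · intro D _
      simp only [relabel_swap_swap]
  rw [key, Finset.sum_product]
  refine Finset.sum_eq_zero fun G hG => ?_
  rw [Finset.mem_filter] at hG
  dsimp only
  rw [← Finset.sum_smul, sum_weight_relabel hm hd hG.1 hG.2, zero_smul]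

theorem symmetrizer_mul_cupCap {m : ℕ} (hm : m ≤ n)
    (hd : ∀ j : ℕ, j + 2 ≤ n → d ≠ -2 * (j : K)) {i j : Fin n} (h : i ≠ j)
    (hi : i.1 < m) (hj : j.1 < m) :
    symmetrizer n d m * diag d (cupCap i j h) = 0 := by
  have := congrArg (mirrorLin n d) (cupCap_mul_symmetrizer hm hd h hi hj)
  rwa [mirrorLin_mul, mirrorLin_symmetrizer, mirrorLin_diag, mirror_cupCap, map_zero] at this

/-- A diagram with a top strand i–j satisfies `cupCap i j` · D = d · D, so annihilation of the
cup-cap passes to D since d ≠ 0. -/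
theorem symmetrizer_mul_diag_of_inl {m : ℕ} (hm : m ≤ n)
    (hd : ∀ j : ℕ, j + 2 ≤ n → d ≠ -2 * (j : K)) {i j : Fin n} {D : BrauerDiagram n}
    (hij : D.1 (Sum.inl i) = Sum.inl j) (hi : i.1 < m) (hj : j.1 < m) :
    symmetrizer n d m * diag d D = 0 := by
  have h : i ≠ j := fun e => D.2.2 (Sum.inl i) (by rw [hij, e])
  have hd0 : d ≠ 0 := by
    -- Two distinct points force n ≥ 2, so the value 0 is among those excluded for `d`.
    have := hd 0 (by have := Fin.val_ne_of_ne h; omega)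
    simpa using this
  have h1 : diag d (cupCap i j h) * diag d D = d • diag d D := by
    rw [cupCap_mul_diag, if_pos hij, hij, Equiv.swap_self]
    rfl
  have h2 : d • (symmetrizer n d m * diag d D) = 0 := by
    rw [← mul_smul_comm, ← h1, ← mul_assoc, symmetrizer_mul_cupCap hm hd h hi hj, zero_mul]
  exact (smul_eq_zero.1 h2).resolve_left hd0

theorem diag_mul_symmetrizer_of_inr {m : ℕ} (hm : m ≤ n)
    (hd : ∀ j : ℕ, j + 2 ≤ n → d ≠ -2 * (j : K)) {i j : Fin n} {D : BrauerDiagram n}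
    (hij : D.1 (Sum.inr i) = Sum.inr j) (hi : i.1 < m) (hj : j.1 < m) :
    diag d D * symmetrizer n d m = 0 := by
  have h1 : (mirror D).1 (Sum.inl i) = Sum.inl j := by
    change (D.1 (Sum.inr i)).swap = _
    rw [hij]; rfl
  have := congrArg (mirrorLin n d) (symmetrizer_mul_diag_of_inl hm hd h1 hi hj)
  rwa [mirrorLin_mul, mirrorLin_symmetrizer, mirrorLin_diag, mirror_mirror, map_zero] at this

theorem permsBelow_mono {m k : ℕ} (h : m ≤ k) : permsBelow n m ⊆ permsBelow n k :=
  fun _ hs => mem_permsBelow.2 fun i hi => mem_permsBelow.1 hs i (h.trans hi)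

theorem filter_lefts_eq_zero (n m : ℕ) :
    (verticalFrom n m).filter (fun D => D.lefts = 0) =
      (permsBelow n m).map ⟨ofPerm, ofPerm_injective⟩ := by
  ext D
  rw [Finset.mem_filter, Finset.mem_map]
  constructor
  · rintro ⟨h1, h2⟩
    obtain ⟨s, rfl⟩ := exists_eq_ofPerm (isRight_of_lefts_eq_zero h2)
    exact ⟨s, ofPerm_mem_verticalFrom.1 h1, rfl⟩
  · rintro ⟨s, hs, rfl⟩
    exact ⟨ofPerm_mem_verticalFrom.2 hs, lefts_ofPerm s⟩

theorem weight_zero (d : K) (m : ℕ) : weight d m 0 = (m.factorial : K)⁻¹ := by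
  simp [weight]

/-- In the first factor, every diagram with a horizontal strand has one at the bottom and is
annihilated by the second. The m! permutations are absorbed, each with coefficient 1/m!. -/
theorem symmetrizer_mul_symmetrizer [CharZero K] {m k : ℕ} (hmk : m ≤ k) (hk : k ≤ n)
    (hd : ∀ j : ℕ, j + 2 ≤ n → d ≠ -2 * (j : K)) :
    symmetrizer n d m * symmetrizer n d k = symmetrizer n d k := by
  nth_rewrite 1 [symmetrizer]
  rw [Finset.sum_mul, ← Finset.sum_filter_add_sum_filter_not _ (fun D => D.lefts = 0),
    filter_lefts_eq_zero, Finset.sum_map]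
  rw [Finset.sum_eq_zero (s := (verticalFrom n m).filter fun D => ¬ D.lefts = 0), add_zero]
  · have h1 : ∀ s ∈ permsBelow n m,
        (weight d m ((ofPerm s).lefts / 2) • diag d (ofPerm s)) * symmetrizer n d k =
          (m.factorial : K)⁻¹ • symmetrizer n d k := by
      intro s hs
      rw [smul_mul_assoc, ofPerm_mul_symmetrizer (permsBelow_mono hmk hs), lefts_ofPerm,
        weight_zero]
    refine (Finset.sum_congr rfl h1).trans ?_
    rw [Finset.sum_const, card_permsBelow (hmk.trans hk), ← Nat.cast_smul_eq_nsmul K, smul_smul,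
      mul_inv_cancel₀ (Nat.cast_ne_zero.2 (Nat.factorial_ne_zero m)), one_smul]
  · intro D hD
    rw [Finset.mem_filter] at hD
    obtain ⟨p, q, hpq⟩ := exists_inr_of_lefts_ne_zero hD.2
    have hqp : D.1 (Sum.inr q) = Sum.inr p := by rw [← hpq, D.2.1]
    rw [smul_mul_assoc, diag_mul_symmetrizer_of_inr hk hd hpq
      ((column_lt_of_apply_inr hD.1 hpq).trans_le hmk)
      ((column_lt_of_apply_inr hD.1 hqp).trans_le hmk), smul_zero]

theorem symmetrizer_mul_symmetrizer' [CharZero K] {m k : ℕ} (hmk : m ≤ k) (hk : k ≤ n)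
    (hd : ∀ j : ℕ, j + 2 ≤ n → d ≠ -2 * (j : K)) :
    symmetrizer n d k * symmetrizer n d m = symmetrizer n d k := by
  have := congrArg (mirrorLin n d) (symmetrizer_mul_symmetrizer hmk hk hd)
  rwa [mirrorLin_mul, mirrorLin_symmetrizer, mirrorLin_symmetrizer] at this

end VTL

/-! ### Surviving diagrams: permutations, twists and one double coset -/

namespace BrauerDiagram

variable {n : ℕ}

/-- Exchanging the two end points of the column `M` turns diagrams that join `M` to other columns
by through strands into diagrams that join `M` to other columns by horizontal strands. -/
def twist (M : Fin n) (D : BrauerDiagram n) : BrauerDiagram n :=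
  relabel (Equiv.swap (Sum.inl M) (Sum.inr M)) D

theorem twist_twist (M : Fin n) (D : BrauerDiagram n) : twist M (twist M D) = D :=
  relabel_swap_swap _ _ _

/-- Because of this equivariance, a double coset decomposition of permutations carries over to their
twists. -/
theorem twist_relabel_sumCongr {M : Fin n} {s t : Equiv.Perm (Fin n)} (hs : s M = M)
    (ht : t M = M) (D : BrauerDiagram n) :
    relabel (Equiv.sumCongr s t) (twist M D) = twist M (relabel (Equiv.sumCongr s t) D) := by
  rw [twist, twist, relabel_relabel, relabel_relabel]
  have := Equiv.mul_swap_eq_swap_mul (Equiv.sumCongr s t) (Sum.inl M) (Sum.inr M)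
  have h1 : Equiv.sumCongr s t (Sum.inl M) = Sum.inl M := congrArg Sum.inl hs
  have h2 : Equiv.sumCongr s t (Sum.inr M) = Sum.inr M := congrArg Sum.inr ht
  rw [h1, h2] at this
  exact congrArg (fun σ => relabel σ D) this

/-- The twist turns v_m into e_m, so the e-term of the recursion can be handled in parallel with the
v-term. -/
theorem twist_ofPerm_swap {i j : Fin n} (h : i ≠ j) :
    twist j (ofPerm (Equiv.swap i j)) = cupCap i j h := by
  apply Subtype.ext
  funext a
  simp only [twist, relabel_apply, Equiv.symm_swap, ofPerm, cupCap]
  rcases a with k | k <;> by_cases hki : k = i <;> by_cases hkj : k = j <;>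
    simp_all [Equiv.swap_apply_def]

theorem twist_ofPerm_inl {M : Fin n} {s : Equiv.Perm (Fin n)} (hM : s M ≠ M) (x : Fin n) :
    ((twist M (ofPerm s)).1 (Sum.inl x)).isLeft ↔ x = M ∨ x = s⁻¹ M := by
  simp only [twist, relabel_apply, Equiv.symm_swap]
  by_cases hx : x = M
  · subst hx
    have h1 : s⁻¹ x ≠ x := fun e => hM (Equiv.Perm.inv_eq_iff_eq.1 e).symm
    have h2 : (ofPerm s).1 (Sum.inr x) = Sum.inl (s⁻¹ x) := rfl
    rw [Equiv.swap_apply_left, h2, Equiv.swap_apply_of_ne_of_ne (by simpa using h1) (by simp)]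
    simp
  · have h2 : (ofPerm s).1 (Sum.inl x) = Sum.inr (s x) := rfl
    have hx' : (Sum.inl x : Fin n ⊕ Fin n) ≠ Sum.inl M := fun e => hx (Sum.inl_injective e)
    rw [Equiv.swap_apply_of_ne_of_ne hx' (by simp), h2]
    by_cases hs : s x = M
    · have : x = s⁻¹ M := by rw [← hs]; simp
      rw [hs, Equiv.swap_apply_right]
      simp [this]
    · have : x ≠ s⁻¹ M := fun e => hs (by rw [e]; simp)
      rw [Equiv.swap_apply_of_ne_of_ne (by simp) (by simpa using hs)]
      exact iff_of_false (by simp) (not_or.2 ⟨hx, this⟩)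

theorem lefts_twist_ofPerm {M : Fin n} {s : Equiv.Perm (Fin n)} (hM : s M ≠ M) :
    (twist M (ofPerm s)).lefts = 2 := by
  have h1 : M ≠ s⁻¹ M := fun e => hM (by nth_rewrite 1 [e]; simp)
  rw [lefts, ← Finset.card_pair h1]
  congr 1
  ext x
  rw [Finset.mem_filter, twist_ofPerm_inl hM]
  simp

theorem twist_ofPerm_mem {m : ℕ} {M : Fin n} (hM : M.1 < m) {s : Equiv.Perm (Fin n)}
    (hs : s ∈ permsBelow n m) : twist M (ofPerm s) ∈ verticalFrom n m :=
  relabel_mem_verticalFrom (ofPerm_mem_verticalFrom.2 hs)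
    (swap_apply_of_column (a := Sum.inl M) (b := Sum.inr M) hM hM)

/-- A diagram on `m + 1` columns without horizontal strands inside the first `m` columns is a
permutation of the first `m + 1` points, or the twist of such a permutation that moves the last
point. -/
theorem eq_ofPerm_or_eq_twist {m : ℕ} (M : Fin n) (hM : M.1 = m) {D : BrauerDiagram n}
    (hD : D ∈ verticalFrom n (m + 1))
    (hl : ∀ p q : Fin n, p.1 < m → q.1 < m → D.1 (Sum.inl p) ≠ Sum.inl q)
    (hr : ∀ p q : Fin n, p.1 < m → q.1 < m → D.1 (Sum.inr p) ≠ Sum.inr q) :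
    ∃ s ∈ permsBelow n (m + 1), D = ofPerm s ∨ (s M ≠ M ∧ D = twist M (ofPerm s)) := by
  have hlt (x : Fin n) (h1 : x.1 < m + 1) (h2 : x ≠ M) : x.1 < m := by
    have := Fin.val_ne_of_ne h2
    omega
  have hinv (x y) (h : D.1 x = y) : D.1 y = x := by rw [← h, D.2.1]
  have hcol {x y : Fin n} (h : D.1 (Sum.inl x) = Sum.inl y) : x = M ∨ y = M := by
    by_contra! hne
    exact hl x y (hlt x (column_lt_of_apply_inl hD h) hne.1)
      (hlt y (column_lt_of_apply_inl hD (hinv _ _ h)) hne.2) h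
  have hcor {x y : Fin n} (h : D.1 (Sum.inr x) = Sum.inr y) : x = M ∨ y = M := by
    by_contra! hne
    exact hr x y (hlt x (column_lt_of_apply_inr hD h) hne.1)
      (hlt y (column_lt_of_apply_inr hD (hinv _ _ h)) hne.2) h
  rcases hDM : D.1 (Sum.inl M) with i | i
  · have hiM : i ≠ M := fun e => D.2.2 (Sum.inl M) (by rw [hDM, e])
    -- The horizontal top strand at `M` forces a horizontal bottom strand, which must also end in
    -- column `M`.
    obtain ⟨j, hj⟩ : ∃ j, D.1 (Sum.inr M) = Sum.inr j := by
      obtain ⟨p, q, hpq⟩ := exists_inr_of_lefts_ne_zero (lefts_pos hDM).ne'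
      rcases hcor hpq with rfl | rfl
      · exact ⟨q, hpq⟩
      · exact ⟨p, hinv _ _ hpq⟩
    have hjM : j ≠ M := fun e => D.2.2 (Sum.inr M) (by rw [hj, e])
    have htw (x : Fin n ⊕ Fin n) : (twist M D).1 x =
        Equiv.swap (Sum.inl M) (Sum.inr M) (D.1 (Equiv.swap (Sum.inl M) (Sum.inr M) x)) := rfl
    have hM' : (twist M D).1 (Sum.inl M) = Sum.inr j := by
      rw [htw, Equiv.swap_apply_left, hj,
        Equiv.swap_apply_of_ne_of_ne (by simp) (by simpa using hjM)]
    have hright : ∀ x, ((twist M D).1 (Sum.inl x)).isRight := by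
      intro x
      by_cases hx : x = M
      · rw [hx, hM']; rfl
      have hx' : (Sum.inl x : Fin n ⊕ Fin n) ≠ Sum.inl M := fun e => hx (Sum.inl_injective e)
      rw [htw, Equiv.swap_apply_of_ne_of_ne hx' (by simp)]
      rcases hDx : D.1 (Sum.inl x) with y | y
      · rcases hcol hDx with h | rfl
        · exact absurd h hx
        · rw [Equiv.swap_apply_left]; rfl
      · have hy : y ≠ M := by
          rintro rfl
          rw [hinv _ _ hDx] at hj
          exact Sum.inl_ne_inr hj
        rw [Equiv.swap_apply_of_ne_of_ne (by simp) (by simpa using hy)]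
        rfl
    obtain ⟨s, hs⟩ := exists_eq_ofPerm hright
    refine ⟨s, ?_, Or.inr ⟨?_, ?_⟩⟩
    · rw [← ofPerm_mem_verticalFrom, ← hs]
      have : column (Sum.inl M : Fin n ⊕ Fin n) < m + 1 := by simp [column, hM]
      exact relabel_mem_verticalFrom hD (swap_apply_of_column this this)
    · rw [hs] at hM'
      have : s M = j := Sum.inr_injective hM'
      rwa [this]
    · rw [← hs, twist_twist]
  · have hright : ∀ x, (D.1 (Sum.inl x)).isRight := by
      intro x
      rcases hDx : D.1 (Sum.inl x) with y | y
      · rcases hcol hDx with rfl | rfl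
        · rw [hDM] at hDx; exact absurd hDx Sum.inr_ne_inl
        · rw [hinv _ _ hDx] at hDM; exact absurd hDM Sum.inl_ne_inr
      · rfl
    obtain ⟨s, rfl⟩ := exists_eq_ofPerm hright
    exact ⟨s, ofPerm_mem_verticalFrom.1 hD, Or.inl rfl⟩

/-- A permutation of the first `m + 1` points that moves the last of them is the product of the
last adjacent transposition with permutations of the first `m` points. -/
theorem exists_eq_mul_swap_mul {m : ℕ} {L M : Fin n} (hL : L.1 + 1 = m) (hM : M.1 = m)
    {s : Equiv.Perm (Fin n)} (hs : s ∈ permsBelow n (m + 1)) (hsM : s M ≠ M) :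
    ∃ a ∈ permsBelow n m, ∃ b ∈ permsBelow n m, s = b * Equiv.swap L M * a := by
  have hs' := mem_permsBelow.1 hs
  have hLM : L ≠ M := fun e => by rw [e] at hL; omega
  obtain ⟨i, hi⟩ := s.surjective M
  have hiM : i ≠ M := fun e => hsM (by rw [← e, hi, e])
  have him : i.1 < m := by
    by_contra! h
    have h2 : m + 1 ≤ i.1 := by have := Fin.val_ne_of_ne hiM; omega
    exact hiM (by rw [← hs' i h2, hi])
  have hne (x : Fin n) (hx : m ≤ x.1) : x ≠ i ∧ x ≠ L := by
    constructor
    · rintro rfl; omega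
    · rintro rfl; omega
  -- Here `i` is the preimage of `M`. The first factor moves `i` to `L` and the transposition moves
  -- it on to `M`, so the remaining factor fixes `M`.
  refine ⟨Equiv.swap i L, ?_, s * Equiv.swap i L * Equiv.swap L M, ?_, ?_⟩
  · exact mem_permsBelow.2 fun x hx => Equiv.swap_apply_of_ne_of_ne (hne x hx).1 (hne x hx).2
  · refine mem_permsBelow.2 fun x hx => ?_
    simp only [Equiv.Perm.mul_apply]
    by_cases hxM : x = M
    · rw [hxM, Equiv.swap_apply_right, Equiv.swap_apply_right, hi]
    · rw [Equiv.swap_apply_of_ne_of_ne (hne x hx).2 hxM,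
        Equiv.swap_apply_of_ne_of_ne (hne x hx).1 (hne x hx).2]
      exact hs' x (by have := Fin.val_ne_of_ne hxM; omega)
  · simp only [mul_assoc, Equiv.swap_mul_self, mul_one]

theorem sumCongr_mul_relabel (s t : Equiv.Perm (Fin n)) (D : BrauerDiagram n) :
    relabel (Equiv.sumCongr 1 t) (relabel (Equiv.sumCongr s 1) D) =
      relabel (Equiv.sumCongr s t) D := by
  rw [relabel_relabel]
  congr 1
  ext a
  rcases a with k | k <;> rfl

end BrauerDiagram

/-! ### The recursion for the symmetrizer, and the conclusion -/

namespace VTL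

open BrauerDiagram

variable {K : Type*} [Field K] {n : ℕ} {d : K}

attribute [local instance] ring algebra

theorem ofPerm_mul_diag_mul_ofPerm (a b : Equiv.Perm (Fin n)) (D : BrauerDiagram n) :
    diag d (ofPerm a) * diag d D * diag d (ofPerm b) =
      diag d (relabel (Equiv.sumCongr a⁻¹ b) D) := by
  rw [ofPerm_mul_diag, diag_mul_ofPerm, sumCongr_mul_relabel]

theorem relabel_ofPerm (a b s : Equiv.Perm (Fin n)) :
    relabel (Equiv.sumCongr a⁻¹ b) (ofPerm s) = ofPerm (b * s * a) := by
  apply Subtype.ext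
  funext x
  rcases x with k | k <;> rfl

/-- By absorption, F_m D F_m depends only on the S_m double coset of D. -/
theorem symmetrizer_mul_ofPerm_mul {m : ℕ} {a b : Equiv.Perm (Fin n)}
    (ha : a ∈ permsBelow n m) (hb : b ∈ permsBelow n m) (D : BrauerDiagram n) :
    symmetrizer n d m * diag d (relabel (Equiv.sumCongr a⁻¹ b) D) * symmetrizer n d m =
      symmetrizer n d m * diag d D * symmetrizer n d m := by
  rw [← ofPerm_mul_diag_mul_ofPerm, ← mul_assoc, ← mul_assoc, symmetrizer_mul_ofPerm ha,
    mul_assoc, ofPerm_mul_symmetrizer hb]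

/-- In the expansion of F_m F_{m+1} F_m, the m! permutations fixing `M` contribute F_m each, while
the m · m! permutations moving `M` and their twists contribute the v-term and the e-term. The
weights at level m+1 with l = 0 and l = 1 turn these counts into x_m, z_m and y_m. -/
theorem symmetrizer_succ [CharZero K] {m : ℕ} {L M : Fin n} (hL : L.1 + 1 = m) (hM : M.1 = m)
    (hLM : L ≠ M) (hd : ∀ j : ℕ, j + 2 ≤ n → d ≠ -2 * (j : K)) :
    symmetrizer n d (m + 1) =
      x K m • symmetrizer n d m +
        y d m • (symmetrizer n d m * diag d (cupCap L M hLM) * symmetrizer n d m) +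
        z K m • (symmetrizer n d m * diag d (ofPerm (Equiv.swap L M)) * symmetrizer n d m) := by
  classical
  have hmn : m + 1 ≤ n := hM ▸ M.2
  have hm : m ≤ n := by omega
  set F := symmetrizer n d m with hF
  have hsand : symmetrizer n d (m + 1) =
      ∑ D ∈ verticalFrom n (m + 1), weight d (m + 1) (D.lefts / 2) • (F * diag d D * F) := by
    have h1 : symmetrizer n d (m + 1) = F * symmetrizer n d (m + 1) * F := by
      rw [symmetrizer_mul_symmetrizer (Nat.le_succ m) hmn hd,
        symmetrizer_mul_symmetrizer' (Nat.le_succ m) hmn hd]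
    refine h1.trans ?_
    simp only [symmetrizer, Finset.mul_sum, Finset.sum_mul, mul_smul_comm, smul_mul_assoc]
  let T : Finset (Equiv.Perm (Fin n)) := (permsBelow n (m + 1)).filter fun s => s M ≠ M
  let X : Finset (BrauerDiagram n) := (permsBelow n (m + 1)).image ofPerm
  let Y : Finset (BrauerDiagram n) := T.image fun s => twist M (ofPerm s)
  have hT (s) (hs : s ∈ T) : s ∈ permsBelow n (m + 1) ∧ s M ≠ M := Finset.mem_filter.1 hs
  have hXY : Disjoint X Y := by
    rw [Finset.disjoint_left]
    rintro D hX hY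
    obtain ⟨s, _, rfl⟩ := Finset.mem_image.1 hX
    obtain ⟨t, ht, hst⟩ := Finset.mem_image.1 hY
    have := lefts_twist_ofPerm (hT t ht).2
    rw [hst, lefts_ofPerm] at this
    omega
  -- `X` holds the permutations and `Y` the twists; they are disjoint since twists of permutations
  -- moving `M` have horizontal strands.
  have hsub : X ∪ Y ⊆ verticalFrom n (m + 1) := by
    intro D hD
    rcases Finset.mem_union.1 hD with h | h
    · obtain ⟨s, hs, rfl⟩ := Finset.mem_image.1 h
      exact ofPerm_mem_verticalFrom.2 hs
    · obtain ⟨s, hs, rfl⟩ := Finset.mem_image.1 h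
      exact twist_ofPerm_mem (by omega) (hT s hs).1
  have hzero : ∀ D ∈ verticalFrom n (m + 1), D ∉ X ∪ Y →
      weight d (m + 1) (D.lefts / 2) • (F * diag d D * F) = 0 := by
    intro D hD hDXY
    by_cases hl : ∀ p q : Fin n, p.1 < m → q.1 < m → D.1 (Sum.inl p) ≠ Sum.inl q
    · by_cases hr : ∀ p q : Fin n, p.1 < m → q.1 < m → D.1 (Sum.inr p) ≠ Sum.inr q
      · exfalso
        obtain ⟨s, hs, rfl | ⟨h1, rfl⟩⟩ := eq_ofPerm_or_eq_twist M hM hD hl hr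
        · exact hDXY (Finset.mem_union_left _ (Finset.mem_image_of_mem _ hs))
        · exact hDXY (Finset.mem_union_right _
            (Finset.mem_image.2 ⟨s, Finset.mem_filter.2 ⟨hs, h1⟩, rfl⟩))
      · push Not at hr
        obtain ⟨p, q, hp, hq, hpq⟩ := hr
        rw [mul_assoc, diag_mul_symmetrizer_of_inr hm hd hpq hp hq, mul_zero, smul_zero]
    · push Not at hl
      obtain ⟨p, q, hp, hq, hpq⟩ := hl
      rw [symmetrizer_mul_diag_of_inl hm hd hpq hp hq, zero_mul, smul_zero]
  have hfix : (permsBelow n (m + 1)).filter (fun s => ¬ s M ≠ M) = permsBelow n m := by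
    ext s
    simp only [Finset.mem_filter, mem_permsBelow, not_not]
    constructor
    · rintro ⟨h1, h2⟩ i hi
      by_cases hiM : i = M
      · rw [hiM, h2]
      · exact h1 i (by have := Fin.val_ne_of_ne hiM; omega)
    · exact fun h => ⟨fun i hi => h i (by omega), h M hM.ge⟩
  have hcard : #T + m.factorial = (m + 1).factorial := by
    rw [← card_permsBelow hmn, ← card_permsBelow hm, ← hfix]
    exact Finset.card_filter_add_card_filter_not _
  have htw_inj : Function.Injective fun s : Equiv.Perm (Fin n) => twist M (ofPerm s) := by
    intro s t hst
    have := congrArg (twist M) hst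
    simp only [twist_twist] at this
    exact ofPerm_injective this
  have hS : ∀ s ∈ T, weight d (m + 1) ((ofPerm s).lefts / 2) • (F * diag d (ofPerm s) * F) =
      weight d (m + 1) 0 • (F * diag d (ofPerm (Equiv.swap L M)) * F) := by
    intro s hs
    obtain ⟨a, ha, b, hb, rfl⟩ := exists_eq_mul_swap_mul hL hM (hT s hs).1 (hT s hs).2
    rw [lefts_ofPerm, ← relabel_ofPerm, hF, symmetrizer_mul_ofPerm_mul ha hb]
  have hS' : ∀ s ∈ T, weight d (m + 1) ((twist M (ofPerm s)).lefts / 2) •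
      (F * diag d (twist M (ofPerm s)) * F) =
      weight d (m + 1) 1 • (F * diag d (cupCap L M hLM) * F) := by
    intro s hs
    rw [lefts_twist_ofPerm (hT s hs).2]
    obtain ⟨a, ha, b, hb, rfl⟩ := exists_eq_mul_swap_mul hL hM (hT s hs).1 (hT s hs).2
    rw [← relabel_ofPerm, ← twist_relabel_sumCongr
      (mem_permsBelow.1 (inv_mem_permsBelow ha) M hM.ge) (mem_permsBelow.1 hb M hM.ge),
      twist_ofPerm_swap hLM, hF, symmetrizer_mul_ofPerm_mul ha hb]
  have hS0 : ∀ s ∈ permsBelow n m,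
      weight d (m + 1) ((ofPerm s).lefts / 2) • (F * diag d (ofPerm s) * F) =
      weight d (m + 1) 0 • F := by
    intro s hs
    rw [lefts_ofPerm, hF, symmetrizer_mul_ofPerm hs, symmetrizer_mul_symmetrizer le_rfl hm hd]
  have hm0 : (m.factorial : K) ≠ 0 := Nat.cast_ne_zero.2 (Nat.factorial_ne_zero m)
  have hm1 : ((m : K) + 1) ≠ 0 := Nat.cast_add_one_ne_zero m
  have hdm : d + 2 * (m : K) - 2 ≠ 0 := by
    intro h0
    -- Since `L` is the point m-1, d + 2m - 2 = 0 would mean d = -2(m-1), and m-1 is in the excluded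
    -- range as m+1 ≤ n.
    apply hd L.1 (by omega)
    rw [← hL] at h0
    push_cast at h0
    linear_combination h0
  have hcardK : (#T : K) = m * m.factorial := by
    have := congrArg (Nat.cast (R := K)) hcard
    rw [Nat.factorial_succ] at this
    push_cast at this
    linear_combination this
  rw [hsand, ← Finset.sum_subset hsub hzero, Finset.sum_union hXY,
    Finset.sum_image (fun _ _ _ _ h => ofPerm_injective h),
    Finset.sum_image (fun _ _ _ _ h => htw_inj h),
    ← Finset.sum_filter_add_sum_filter_not _ (fun s : Equiv.Perm (Fin n) => s M ≠ M), hfix,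
    Finset.sum_congr rfl hS, Finset.sum_congr rfl hS', Finset.sum_congr rfl hS0,
    Finset.sum_const, Finset.sum_const, Finset.sum_const, card_permsBelow hm,
    ← Nat.cast_smul_eq_nsmul K, ← Nat.cast_smul_eq_nsmul K, ← Nat.cast_smul_eq_nsmul K,
    smul_smul, smul_smul, smul_smul, hcardK]
  have hx : (m.factorial : K) * weight d (m + 1) 0 = x K m := by
    rw [weight_zero, x, Nat.factorial_succ]
    push_cast
    field_simp
  have hz : (m : K) * m.factorial * weight d (m + 1) 0 = z K m := by
    rw [weight_zero, z, Nat.factorial_succ]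
    push_cast
    field_simp
  have hy : (m : K) * m.factorial * weight d (m + 1) 1 = y d m := by
    -- The single factor of the weight with l = 1 on m+1 strands is the denominator d + 2m - 2 of
    -- y_m.
    have e : d + 2 * ((m : K) + 1) - 2 - 2 * 1 = d + 2 * (m : K) - 2 := by ring
    rw [weight, y, Nat.factorial_succ m]
    push_cast
    rw [Finset.Icc_self, Finset.prod_singleton, Nat.factorial_one, Nat.cast_one, e]
    field_simp
  rw [hx, hy, hz]
  abel

/-- With one free column the number of ends of horizontal top strands is at most 1 and even, hence
0; only the identity permutation remains. -/
theorem symmetrizer_one (hn : 1 ≤ n) : symmetrizer n d 1 = 1 := by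
  have h : verticalFrom n 1 = {ofPerm 1} := by
    ext D
    rw [Finset.mem_singleton]
    constructor
    · intro hD
      obtain ⟨s, rfl⟩ : ∃ s, D = ofPerm s := by
        refine exists_eq_ofPerm (isRight_of_lefts_eq_zero ?_)
        have h1 := lefts_le hn hD
        obtain ⟨k, hk⟩ := even_lefts D
        omega
      have h1 : ∀ i : Fin n, 1 ≤ i.1 → s i = i :=
        mem_permsBelow.1 (ofPerm_mem_verticalFrom.1 hD)
      have hs : s = 1 := by
        ext i
        by_cases hi : 1 ≤ i.1
        · rw [h1 i hi]; rfl
        · by_cases hsi : 1 ≤ (s i).1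
          · rw [s.injective (h1 _ hsi)]; rfl
          · simp only [Equiv.Perm.one_apply]; omega
      rw [hs]
    · rintro rfl
      exact ofPerm_mem_verticalFrom.2 (mem_permsBelow.2 fun _ _ => rfl)
  rw [symmetrizer, h, Finset.sum_singleton, lefts_ofPerm, weight_zero, one_eq]
  simp

theorem f_eq_symmetrizer [CharZero K] (hd : ∀ j : ℕ, j + 2 ≤ n → d ≠ -2 * (j : K)) (i : ℕ)
    (h : i + 1 ≤ n) : f n d (i + 1) h = symmetrizer n d (i + 1) := by
  induction i with
  | zero => rw [symmetrizer_one h]; rfl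
  | succ i ih =>
    rw [symmetrizer_succ (m := i + 1) (L := ⟨i, by omega⟩) (M := ⟨i + 1, h⟩) rfl rfl (by simp) hd,
      ← ih (by omega)]
    rfl

/-- For m = n no column is forced to be vertical, and a diagram with l horizontal top strands has n
- 2l through strands, so grouping by l gives the sums [n-2l]_n. -/
theorem symmetrizer_self (n : ℕ) (d : K) :
    symmetrizer n d n =
      ∑ l ∈ Finset.range (n / 2 + 1), weight d n l • throughSum n d (n - 2 * l) := by
  have hv : verticalFrom n n = Finset.univ := by
    ext D
    simp only [mem_verticalFrom, Finset.mem_univ, iff_true]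
    intro i hi
    exact absurd i.2 (not_lt.2 hi)
  have hmaps : ∀ D ∈ (Finset.univ : Finset (BrauerDiagram n)),
      D.lefts / 2 ∈ Finset.range (n / 2 + 1) := by
    intro D _
    have := through_add_lefts D
    rw [Finset.mem_range]
    omega
  rw [symmetrizer, hv, ← Finset.sum_fiberwise_of_maps_to hmaps]
  refine Finset.sum_congr rfl fun l hl => ?_
  rw [throughSum, Finset.smul_sum]
  rw [Finset.mem_range] at hl
  refine Finset.sum_congr ?_ ?_
  · ext D
    simp only [Finset.mem_filter, Finset.mem_univ, true_and]
    have := through_add_lefts D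
    obtain ⟨k, hk⟩ := even_lefts D
    omega
  · intro D hD
    have h1 := (Finset.mem_filter.1 hD).2
    have := through_add_lefts D
    have h2 : D.lefts / 2 = l := by omega
    rw [h2]

end VTL

theorem mainTheorem3 {K : Type*} [Field K] [CharZero K] (d : K) (n : ℕ) (hn : 1 ≤ n)
    (hd : ∀ j : ℕ, j + 2 ≤ n → d ≠ -2 * (j : K)) :
    VTL.f n d n le_rfl =
      ∑ l ∈ Finset.range (n / 2 + 1),
        ((-2 : K) ^ l * (l.factorial : K) /
            ((n.factorial : K) * ∏ i ∈ Finset.Icc 1 l, (d + 2 * (n : K) - 2 - 2 * (i : K)))) •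
          VTL.throughSum n d (n - 2 * l) := by
  obtain ⟨i, rfl⟩ : ∃ i, n = i + 1 := ⟨n - 1, by omega⟩
  rw [VTL.f_eq_symmetrizer hd, VTL.symmetrizer_self]
  rfl
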